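/- Theorem. A non-increasing sequence $d=(d_1,\dots,d_n)$ of positive integers is called graphic if it has a realization, that is, a simple undirected graph $G$ on the vertex set $\{1,\dots,n\}$ with $\deg_G(i)=d_i$ for every $i$. A dominating set of $G$ is a set $D$ of vertices such that every vertex outside $D$ has a neighbour in $D$. There is a polynomial-time algorithm (running time polynomial in $n$) that, given a graphic sequence $d=(d_1,\dots,d_n)$, constructs a realization $G$ of $d$ that has a dominating set of minimum size among all dominating sets of all realizations of $d$. In other words, the size of a minimum dominating set of $G$ is smallest among all realizations of $d$. -/

import Mathlib

/-! ## Dominating sets and realizations of degree sequences -/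

/-- `D` is a dominating set of `G`: every vertex outside `D` has a neighbour in `D`. -/
def IsDominatingSet {n : ℕ} (G : SimpleGraph (Fin n)) (D : Finset (Fin n)) : Prop :=
  ∀ v, v ∉ D → ∃ u ∈ D, G.Adj u v

/-- `MDS(G)`: the least size of a dominating set of `G` (the whole vertex set is one, so that
the infimum is attained). -/
noncomputable def dominationNumber {n : ℕ} (G : SimpleGraph (Fin n)) : ℕ :=
  sInf {k | ∃ D : Finset (Fin n), IsDominatingSet G D ∧ D.card = k}

/-- `G` realizes `d`: the vertex `i` has degree `d i`, for every `i`. -/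
def Realizes {n : ℕ} (G : SimpleGraph (Fin n)) (d : Fin n → ℕ) : Prop :=
  ∀ i, (G.neighborSet i).ncard = d i

/-- `d` is graphic: a non-increasing sequence of positive integers that is the degree sequence of
some simple graph. -/
def IsGraphic {n : ℕ} (d : Fin n → ℕ) : Prop :=
  Antitone d ∧ (∀ i, 0 < d i) ∧ ∃ G : SimpleGraph (Fin n), Realizes G d

/-- `G` is a realization of `d` that has a dominating set of the minimum size among all
dominating sets of all realizations of `d`, that is, `MDS(G) = MDS(d)`. -/
def IsOptimalRealization {n : ℕ} (G : SimpleGraph (Fin n)) (d : Fin n → ℕ) : Prop :=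
  Realizes G d ∧
    ∀ G' : SimpleGraph (Fin n), Realizes G' d → dominationNumber G ≤ dominationNumber G'

/-! ## The machine model

A random access machine over the natural numbers, programmed in a structured language with
variables, arrays, addition, truncated subtraction, branching and loops. There is no
multiplication: one unit of cost makes the bit length of the largest number in use grow by at most
one (apart from the finitely many constants of the program), and it touches at most one memory
cell. Hence the cost is polynomially related to the running time of a Turing machine. -/

namespace RAM

/-- A configuration of the memory: the variable `x` holds `var x`, and the cell `i` of the
array `a` holds `arr a i`. A program mentions only finitely many variables and arrays. -/
structure Memory where
  var : ℕ → ℕ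
  arr : ℕ → ℕ → ℕ

/-- Arithmetic terms. -/
inductive Term where
  | lit (k : ℕ)
  | var (x : ℕ)
  | get (a : ℕ) (i : Term)
  | add (s t : Term)
  | sub (s t : Term)

/-- The value of a term. -/
def Term.eval (m : Memory) : Term → ℕ
  | .lit k => k
  | .var x => m.var x
  | .get a i => m.arr a (i.eval m)
  | .add s t => s.eval m + t.eval m
  | .sub s t => s.eval m - t.eval m

/-- The cost of evaluating a term: one unit for each constant, variable access, array access and
arithmetic operation. -/
def Term.cost : Term → ℕ
  | .lit _ => 1
  | .var _ => 1
  | .get _ i => i.cost + 1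
  | .add s t => s.cost + t.cost + 1
  | .sub s t => s.cost + t.cost + 1

/-- Programs. -/
inductive Program where
  /-- do nothing -/
  | skip
  /-- `x := t` -/
  | assign (x : ℕ) (t : Term)
  /-- `a[i] := t` -/
  | store (a : ℕ) (i t : Term)
  /-- first `p`, then `q` -/
  | seq (p q : Program)
  /-- if `t ≠ 0` then `p` else `q` -/
  | cond (t : Term) (p q : Program)
  /-- while `t ≠ 0` do `p` -/
  | loop (t : Term) (p : Program)

/-- The memory after `x := v`. -/
def Memory.setVar (m : Memory) (x v : ℕ) : Memory :=
  { m with var := Function.update m.var x v }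

/-- The memory after `a[i] := v`. -/
def Memory.setArr (m : Memory) (a i v : ℕ) : Memory :=
  { m with arr := Function.update m.arr a (Function.update (m.arr a) i v) }

/-- `Runs p m m' c`: started with memory `m`, the program `p` halts with memory `m'` after
`c` units of cost. -/
inductive Runs : Program → Memory → Memory → ℕ → Prop
  | skip (m : Memory) : Runs .skip m m 1
  | assign (m : Memory) (x : ℕ) (t : Term) :
      Runs (.assign x t) m (m.setVar x (t.eval m)) (t.cost + 1)
  | store (m : Memory) (a : ℕ) (i t : Term) :
      Runs (.store a i t) m (m.setArr a (i.eval m) (t.eval m)) (i.cost + t.cost + 1)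
  | seq {p q : Program} {m₁ m₂ m₃ : Memory} {b c : ℕ} :
      Runs p m₁ m₂ b → Runs q m₂ m₃ c → Runs (.seq p q) m₁ m₃ (b + c)
  | condTrue {t : Term} {p q : Program} {m m' : Memory} {c : ℕ} :
      t.eval m ≠ 0 → Runs p m m' c → Runs (.cond t p q) m m' (t.cost + 1 + c)
  | condFalse {t : Term} {p q : Program} {m m' : Memory} {c : ℕ} :
      t.eval m = 0 → Runs q m m' c → Runs (.cond t p q) m m' (t.cost + 1 + c)
  | loopTrue {t : Term} {p : Program} {m₁ m₂ m₃ : Memory} {b c : ℕ} :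
      t.eval m₁ ≠ 0 → Runs p m₁ m₂ b → Runs (.loop t p) m₂ m₃ c →
        Runs (.loop t p) m₁ m₃ (t.cost + 1 + b + c)
  | loopFalse {t : Term} {p : Program} {m : Memory} :
      t.eval m = 0 → Runs (.loop t p) m m (t.cost + 1)

end RAM

/-- The memory that presents the sequence `d` to a program: variable `0` holds the length `n`,
array `0` holds the sequence, and everything else is zero. -/
def inputMemory {n : ℕ} (d : Fin n → ℕ) : RAM.Memory where
  var x := if x = 0 then n else 0
  arr a i := if h : a = 0 ∧ i < n then d ⟨i, h.2⟩ else 0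

open Classical in
/-- Array `1` of the memory `m` holds the adjacency matrix of `G`, row by row. -/
def OutputsGraph {n : ℕ} (m : RAM.Memory) (G : SimpleGraph (Fin n)) : Prop :=
  ∀ i j : Fin n, m.arr 1 (i.val * n + j.val) = if G.Adj i j then 1 else 0

set_option linter.unusedSectionVars false

/-! Let `D` be the set of the first `k` vertices. If some realization has a dominating set of size
`k`, then some realization is dominated by `D` (`exists_isDominatingSet_initial`). Indeed, a member
of a dominating set whose degree is smaller than that of a vertex outside can be exchanged for a
vertex of larger degree, after a change of the graph that keeps all degrees (`exists_exchange`);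
vertices of equal degree are simply transposed.

A realization dominated by `D` leaves a trace, a state (`IsState`): the graph `H` outside `D`, the
numbers `e v` of edges from `v ∉ D` to `D`, with `1 ≤ e v ≤ k`, and the number `m` of edges inside
`D`. Of the degrees in `D` only their sum is remembered, so a state need not come from a
realization. It does, however, if `k` is the least number that admits a state and `m` is then the
least possible (`IsState.exists_split`). When few vertices have `e v ≥ 2`, compared with the least
degree in `D`, the edges of these vertices and the edges inside `D` can be chosen arbitrarily, and
the vertices with `e v = 1` supply whatever `D` still lacks. When there are many, `descent` moves
the last vertex out of `D` or lowers `m`, against minimality. If vertices joined to all of `D` block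
this, `H` is rebuilt so that the sum of the `e v ^ 2` drops; if no rebuilding is possible, the
Erdős–Gallai inequality `sum_deg_le` fails. Hence the least `k` that admits a state is the optimum.

The program searches over `k` and over the excess `E`, the sum of the `e v - 1`; the degree sum then
determines `m`. For given `k` and `E` it is greedy: it raises `e` at vertices of largest residual
degree (`IsState.exists_raise`), and builds `H` and then the edges that meet `D` in the manner of
Havel and Hakimi (`IsCompletion.exists_addEdge`). A final test that no residual degree is left makes
every success sound, and the minimality of `k` and `m` forces a success at the optimal `k` at the
latest. No loop runs more than `n * n + n + 1` times, which bounds the cost by a polynomial. -/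

namespace DomRealization

open Finset

/-! ### Degrees under edge changes, and an Erdős–Gallai inequality. -/

section Graph

variable {V : Type*} [Fintype V]

open Classical in
/-- The neighbourhood of a vertex as a finite set. -/
noncomputable def nbr (G : SimpleGraph V) (v : V) : Finset V := univ.filter (G.Adj v)

/-- The degree of a vertex. -/
noncomputable def deg (G : SimpleGraph V) (v : V) : ℕ := (nbr G v).card

@[simp] theorem mem_nbr {G : SimpleGraph V} {v w : V} : w ∈ nbr G v ↔ G.Adj v w := by
  simp [nbr]

theorem ncard_neighborSet (G : SimpleGraph V) (v : V) : (G.neighborSet v).ncard = deg G v := by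
  rw [deg, ← Set.ncard_coe_finset]
  congr 1
  ext w
  simp

theorem deg_pos_iff {G : SimpleGraph V} {v : V} : 0 < deg G v ↔ ∃ w, G.Adj v w := by
  simp [deg, Finset.card_pos, Finset.Nonempty]

theorem deg_pos {G : SimpleGraph V} {v w : V} (h : G.Adj v w) : 0 < deg G v :=
  deg_pos_iff.2 ⟨w, h⟩

theorem deg_lt_card (G : SimpleGraph V) (v : V) : deg G v < Fintype.card V := by
  classical
  have : nbr G v ⊂ univ := by
    refine Finset.ssubset_univ_iff.2 fun h => ?_
    have : v ∈ nbr G v := by rw [h]; exact mem_univ v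
    simp at this
  exact Finset.card_lt_card this

/-- Add the edge `uw`. -/
def addEdge (G : SimpleGraph V) (u w : V) : SimpleGraph V := G ⊔ SimpleGraph.edge u w

/-- Delete the edge `uw`. -/
def delEdge (G : SimpleGraph V) (u w : V) : SimpleGraph V := G \ SimpleGraph.edge u w

theorem addEdge_adj {G : SimpleGraph V} {u w a b : V} (h : u ≠ w) :
    (addEdge G u w).Adj a b ↔ G.Adj a b ∨ (a = u ∧ b = w) ∨ (a = w ∧ b = u) := by
  simp only [addEdge, SimpleGraph.sup_adj, SimpleGraph.edge_adj]
  grind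

theorem delEdge_adj {G : SimpleGraph V} {u w a b : V} :
    (delEdge G u w).Adj a b ↔ G.Adj a b ∧ ¬ ((a = u ∧ b = w) ∨ (a = w ∧ b = u)) := by
  simp only [delEdge, SimpleGraph.sdiff_adj, SimpleGraph.edge_adj]
  constructor
  · rintro ⟨h, h'⟩
    exact ⟨h, fun hh => h' ⟨by grind, h.ne⟩⟩
  · rintro ⟨h, h'⟩
    exact ⟨h, fun hh => h' (by grind)⟩

variable [DecidableEq V]

theorem deg_addEdge {G : SimpleGraph V} {u w : V} (h : u ≠ w) (h' : ¬ G.Adj u w) (a : V) :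
    deg (addEdge G u w) a = deg G a + (if a = u then 1 else 0) + (if a = w then 1 else 0) := by
  have h'' : ¬ G.Adj w u := fun hh => h' hh.symm
  unfold deg
  by_cases hu : a = u
  · have : nbr (addEdge G u w) a = insert w (nbr G a) := by
      ext b; simp only [mem_nbr, addEdge_adj h, mem_insert]; grind
    rw [this, card_insert_of_notMem (by simpa [hu] using h')]
    grind
  · by_cases hw : a = w
    · have : nbr (addEdge G u w) a = insert u (nbr G a) := by
        ext b; simp only [mem_nbr, addEdge_adj h, mem_insert]; grind
      rw [this, card_insert_of_notMem (by simpa [hw] using h'')]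
      grind
    · have : nbr (addEdge G u w) a = nbr G a := by
        ext b; simp only [mem_nbr, addEdge_adj h]; grind
      rw [this]; simp [hu, hw]

theorem addEdge_delEdge {G : SimpleGraph V} {u w : V} (h : G.Adj u w) :
    addEdge (delEdge G u w) u w = G := by
  ext a b
  rw [addEdge_adj h.ne, delEdge_adj]
  have := h.symm
  grind

theorem deg_delEdge {G : SimpleGraph V} {u w : V} (h : G.Adj u w) (a : V) :
    deg (delEdge G u w) a + (if a = u then 1 else 0) + (if a = w then 1 else 0) = deg G a := by
  conv_rhs => rw [← addEdge_delEdge h]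
  rw [deg_addEdge h.ne]
  simp [delEdge_adj]

/-- If `u` has at least the degree of `x` and `x` has a neighbour that `u` lacks, then `u` has a
neighbour that `x` lacks. -/
theorem exists_adj_not_adj {G : SimpleGraph V} {u x v : V} (hle : deg G x ≤ deg G u)
    (hx : G.Adj x v) (hu : ¬ G.Adj u v) (hvu : v ≠ u) :
    ∃ z, G.Adj u z ∧ ¬ G.Adj x z ∧ z ≠ x := by
  by_contra hcon
  push Not at hcon
  have hsub : (nbr G u).erase x ⊆ ((nbr G x).erase u).erase v := by
    intro z hz
    simp only [mem_erase, mem_nbr] at hz ⊢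
    refine ⟨fun h => hu (h ▸ hz.2), hz.2.ne', ?_⟩
    by_contra h
    exact hz.1 (hcon z hz.2 h)
  have hc := card_le_card hsub
  have hvm : v ∈ (nbr G x).erase u := by simp [hx, hvu]
  rw [card_erase_of_mem hvm] at hc
  have hpos := card_pos.2 ⟨v, hvm⟩
  unfold deg at hle
  by_cases hux : G.Adj u x
  · rw [card_erase_of_mem (by simpa using hux), card_erase_of_mem (by simpa using hux.symm)] at hc
    rw [card_erase_of_mem (by simpa using hux.symm)] at hpos
    omega
  · rw [erase_eq_of_notMem (by simpa using hux),
      erase_eq_of_notMem (s := nbr G x) (by simpa using fun h => hux h.symm)] at hc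
    rw [erase_eq_of_notMem (s := nbr G x) (by simpa using fun h => hux h.symm)] at hpos
    omega

/-- The variant of `exists_adj_not_adj` in which a strict inequality of degrees replaces the private
neighbour `v` of `x`. -/
theorem exists_adj_not_adj_of_lt {G : SimpleGraph V} {v w : V} (hlt : deg G w < deg G v) :
    ∃ z, G.Adj v z ∧ ¬ G.Adj w z ∧ z ≠ w := by
  by_contra hcon
  push Not at hcon
  have hsub : (nbr G v).erase w ⊆ (nbr G w).erase v := by
    intro z hz
    simp only [mem_erase, mem_nbr] at hz ⊢
    refine ⟨hz.2.ne', ?_⟩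
    by_contra h
    exact hz.1 (hcon z hz.2 h)
  have hc := card_le_card hsub
  unfold deg at hlt
  by_cases hux : G.Adj v w
  · rw [card_erase_of_mem (by simpa using hux), card_erase_of_mem (by simpa using hux.symm)] at hc
    have : 0 < (nbr G w).card := card_pos.2 ⟨v, by simpa using hux.symm⟩
    omega
  · rw [erase_eq_of_notMem (by simpa using hux),
      erase_eq_of_notMem (s := nbr G w) (by simpa using fun h => hux h.symm)] at hc
    omega

/-- Replace the edge `vz` by `wz`. -/
def moveEdge (G : SimpleGraph V) (v w z : V) : SimpleGraph V := addEdge (delEdge G v z) w z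

theorem moveEdge_adj {G : SimpleGraph V} {v w z a b : V} (hwz : w ≠ z) :
    (moveEdge G v w z).Adj a b ↔
      (G.Adj a b ∧ ¬ ((a = v ∧ b = z) ∨ (a = z ∧ b = v))) ∨
        (a = w ∧ b = z) ∨ (a = z ∧ b = w) := by
  rw [moveEdge, addEdge_adj hwz, delEdge_adj]

theorem deg_moveEdge {G : SimpleGraph V} {v w z : V} (hvz : G.Adj v z) (hwz : ¬ G.Adj w z)
    (hne : w ≠ z) (a : V) :
    deg (moveEdge G v w z) a + (if a = v then 1 else 0) = deg G a + (if a = w then 1 else 0) := by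
  rw [moveEdge, deg_addEdge hne (by rw [delEdge_adj]; tauto)]
  have := deg_delEdge hvz a
  grind

/-- Replace the edges `ab`, `cd` by `ac`, `bd`. -/
def switch (G : SimpleGraph V) (a b c d : V) : SimpleGraph V :=
  addEdge (addEdge (delEdge (delEdge G a b) c d) a c) b d

theorem switch_adj {G : SimpleGraph V} {a b c d x y : V} (hac : a ≠ c) (hbd : b ≠ d) :
    (switch G a b c d).Adj x y ↔
      (G.Adj x y ∧ ¬ ((x = a ∧ y = b) ∨ (x = b ∧ y = a)) ∧
        ¬ ((x = c ∧ y = d) ∨ (x = d ∧ y = c))) ∨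
        ((x = a ∧ y = c) ∨ (x = c ∧ y = a)) ∨ ((x = b ∧ y = d) ∨ (x = d ∧ y = b)) := by
  rw [switch, addEdge_adj hbd, addEdge_adj hac, delEdge_adj, delEdge_adj,
    and_assoc, or_assoc]

theorem deg_switch {G : SimpleGraph V} {a b c d : V} (hab : G.Adj a b) (hcd : G.Adj c d)
    (hac : ¬ G.Adj a c) (hbd : ¬ G.Adj b d) (hac' : a ≠ c) (hbd' : b ≠ d) (x : V) :
    deg (switch G a b c d) x = deg G x := by
  have had : a ≠ d := fun h => hac (h ▸ hcd.symm)
  have hbc : b ≠ c := fun h => hac (h ▸ hab)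
  have h1 := deg_delEdge hab x
  have hcd' : (delEdge G a b).Adj c d := by rw [delEdge_adj]; grind
  have h2 := deg_delEdge hcd' x
  have hac2 : ¬ (delEdge (delEdge G a b) c d).Adj a c := by
    rw [delEdge_adj, delEdge_adj]; tauto
  have h3 := deg_addEdge hac' hac2 x
  have hbd2 : ¬ (addEdge (delEdge (delEdge G a b) c d) a c).Adj b d := by
    have := hab.ne
    have := hcd.ne
    rw [addEdge_adj hac', delEdge_adj, delEdge_adj]; grind
  have h4 := deg_addEdge hbd' hbd2 x
  rw [switch]
  grind

/-- The sum of the degrees over a set `S` is at most the number of ordered pairs in `S` plus what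
the other vertices can contribute. -/
theorem sum_deg_le (G : SimpleGraph V) (S : Finset V) :
    ∑ i ∈ S, deg G i ≤ S.card * (S.card - 1) + ∑ v ∈ Sᶜ, min (deg G v) S.card := by
  classical
  have key : ∀ i, deg G i = ∑ j, if G.Adj i j then 1 else 0 := by
    intro i; rw [deg, nbr, card_filter]
  have h1 : ∑ i ∈ S, deg G i = ∑ i ∈ S, ((nbr G i) ∩ S).card + ∑ i ∈ S, ((nbr G i) ∩ Sᶜ).card := by
    rw [← sum_add_distrib]
    refine sum_congr rfl fun i _ => ?_
    rw [deg, ← card_union_of_disjoint, ← inter_union_distrib_left]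
    · simp
    · exact (disjoint_compl_right.mono inter_subset_right inter_subset_right)
  have h2 : ∑ i ∈ S, ((nbr G i) ∩ S).card ≤ S.card * (S.card - 1) := by
    rw [← smul_eq_mul]
    refine sum_le_card_nsmul _ _ _ fun i hi => ?_
    rw [← card_erase_of_mem hi]
    refine card_le_card fun j hj => ?_
    simp only [mem_inter, mem_nbr] at hj
    exact mem_erase.2 ⟨hj.1.ne', hj.2⟩
  have h3 : ∑ i ∈ S, ((nbr G i) ∩ Sᶜ).card = ∑ v ∈ Sᶜ, ((nbr G v) ∩ S).card := by
    have e1 : ∀ (A : Finset V) (i : V), ((nbr G i) ∩ A).card = ∑ j ∈ A, if G.Adj i j then 1 else 0 := by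
      intro A i
      rw [← card_filter]
      congr 1
      ext j; simp [and_comm]
    simp only [e1]
    rw [sum_comm]
    refine sum_congr rfl fun v _ => sum_congr rfl fun i _ => ?_
    simp [G.adj_comm]
  rw [h1, h3]
  refine add_le_add h2 (sum_le_sum fun v _ => le_min ?_ ?_)
  · exact card_le_card inter_subset_left
  · exact card_le_card inter_subset_right

end Graph

/-! ### Moving a dominating set to the vertices of highest degree. -/

section Exchange

variable {n : ℕ}

/-- Exchange the roles of `i` and `j` with respect to the vertices of `S`. -/
def swapOn (G : SimpleGraph (Fin n)) (i j : Fin n) (S : Finset (Fin n)) (hi : i ∉ S)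
    (hj : j ∉ S) : SimpleGraph (Fin n) where
  Adj a b := if a ∈ S then G.Adj a (Equiv.swap i j b) else
    if b ∈ S then G.Adj (Equiv.swap i j a) b else G.Adj a b
  symm := ⟨by
    have key : ∀ x ∈ S, Equiv.swap i j x = x := fun x hx =>
      Equiv.swap_apply_of_ne_of_ne (fun h => hi (h ▸ hx)) (fun h => hj (h ▸ hx))
    intro a b h
    by_cases ha : a ∈ S <;> by_cases hb : b ∈ S <;> simp only [ha, hb, if_true, if_false] at h ⊢
    · rw [key a ha]; rw [key b hb] at h; exact h.symm
    · exact h.symm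
    · exact h.symm
    · exact h.symm⟩
  loopless := ⟨by
    have key : ∀ x ∈ S, Equiv.swap i j x = x := fun x hx =>
      Equiv.swap_apply_of_ne_of_ne (fun h => hi (h ▸ hx)) (fun h => hj (h ▸ hx))
    intro a h
    by_cases ha : a ∈ S <;> simp only [ha, if_true, if_false] at h
    · rw [key a ha] at h; exact G.irrefl h
    · exact G.irrefl h⟩

theorem swapOn_adj {G : SimpleGraph (Fin n)} {i j : Fin n} {S : Finset (Fin n)} {hi : i ∉ S}
    {hj : j ∉ S} {a b : Fin n} : (swapOn G i j S hi hj).Adj a b ↔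
      if a ∈ S then G.Adj a (Equiv.swap i j b) else
        if b ∈ S then G.Adj (Equiv.swap i j a) b else G.Adj a b := Iff.rfl

/-- A vertex of `Z ∪ Y` only has `i` and `j` interchanged in its neighbourhood. The vertex `i`
trades `Y` for `Z` and `j` trades `Z` for `Y`, so equal sizes keep both degrees. -/
theorem deg_swapOn {G : SimpleGraph (Fin n)} {i j : Fin n} (hij : i ≠ j) {Z Y : Finset (Fin n)}
    (hZ : ∀ z ∈ Z, G.Adj j z ∧ ¬ G.Adj i z ∧ z ≠ i) (hY : ∀ y ∈ Y, G.Adj i y ∧ ¬ G.Adj j y ∧ y ≠ j)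
    (hc : Y.card = Z.card) (hi : i ∉ Z ∪ Y) (hj : j ∉ Z ∪ Y) (a : Fin n) :
    deg (swapOn G i j (Z ∪ Y) hi hj) a = deg G a := by
  unfold deg
  by_cases ha : a ∈ Z ∪ Y
  · refine card_bij' (fun b _ => Equiv.swap i j b) (fun b _ => Equiv.swap i j b) ?_ ?_ ?_ ?_
    · intro b hb
      rw [mem_nbr, swapOn_adj, if_pos ha] at hb
      simpa using hb
    · intro b hb
      rw [mem_nbr, swapOn_adj, if_pos ha]
      simpa using hb
    · simp
    · simp
  · by_cases hai : a = i
    · subst hai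
      have e : nbr (swapOn G a j (Z ∪ Y) hi hj) a = (nbr G a \ Y) ∪ Z := by
        ext b
        rw [mem_nbr, swapOn_adj, if_neg ha, Equiv.swap_apply_left]
        have := hZ b
        have := hY b
        by_cases hbZ : b ∈ Z <;> by_cases hbY : b ∈ Y <;> simp_all
      have hsub : Y ⊆ nbr G a := fun y hy => by simpa using (hY y hy).1
      have hdis : Disjoint (nbr G a \ Y) Z := by
        rw [disjoint_left]; intro z hz hz'
        simp only [mem_sdiff, mem_nbr] at hz
        exact (hZ z hz').2.1 hz.1
      rw [e, card_union_of_disjoint hdis, card_sdiff_of_subset hsub]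
      have := card_le_card hsub
      omega
    · by_cases haj : a = j
      · subst haj
        have e : nbr (swapOn G i a (Z ∪ Y) hi hj) a = (nbr G a \ Z) ∪ Y := by
          ext b
          rw [mem_nbr, swapOn_adj, if_neg ha, Equiv.swap_apply_right]
          have := hZ b
          have := hY b
          by_cases hbZ : b ∈ Z <;> by_cases hbY : b ∈ Y <;> simp_all
        have hsub : Z ⊆ nbr G a := fun y hy => by simpa using (hZ y hy).1
        have hdis : Disjoint (nbr G a \ Z) Y := by
          rw [disjoint_left]; intro z hz hz'
          simp only [mem_sdiff, mem_nbr] at hz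
          exact (hY z hz').2.1 hz.1
        rw [e, card_union_of_disjoint hdis, card_sdiff_of_subset hsub]
        have := card_le_card hsub
        omega
      · congr 1
        ext b
        rw [mem_nbr, mem_nbr, swapOn_adj, if_neg ha, Equiv.swap_apply_of_ne_of_ne hai haj, ite_self]

/-- If `i ∉ D` has larger degree than `j ∈ D`, then in some realization of the same degrees
`j` can be replaced by a vertex of larger degree. -/
theorem exists_exchange {G : SimpleGraph (Fin n)} {D : Finset (Fin n)} (hD : IsDominatingSet G D)
    {i j : Fin n} (hi : i ∉ D) (hj : j ∈ D) (hlt : deg G j < deg G i) (hpos : 0 < deg G j) :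
    ∃ (G' : SimpleGraph (Fin n)) (x : Fin n), x ∉ D ∧ deg G j < deg G x ∧
      (∀ v, deg G' v = deg G v) ∧ IsDominatingSet G' (insert x (D.erase j)) := by
  have hij : i ≠ j := fun h => hi (h ▸ hj)
  obtain ⟨u, huD, hui⟩ := hD i hi
  set Z : Finset (Fin n) := (nbr G j \ nbr G i).erase i with hZdef
  set W : Finset (Fin n) := (nbr G i \ nbr G j).erase j with hWdef
  have hZ : ∀ z, z ∈ Z ↔ G.Adj j z ∧ ¬ G.Adj i z ∧ z ≠ i := by intro z; simp [Z]; tauto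
  have hW : ∀ z, z ∈ W ↔ G.Adj i z ∧ ¬ G.Adj j z ∧ z ≠ j := by intro z; simp [W]; tauto
  have hcard : Z.card ≤ W.card := by
    have h1 := card_sdiff_add_card_inter (nbr G j) (nbr G i)
    have h2 := card_sdiff_add_card_inter (nbr G i) (nbr G j)
    rw [inter_comm] at h2
    unfold deg at hlt
    by_cases h : G.Adj i j
    · rw [hZdef, hWdef, card_erase_of_mem (by simp [h.symm]), card_erase_of_mem (by simp [h])]
      omega
    · rw [hZdef, hWdef, erase_eq_of_notMem (by simp [G.adj_comm j i, h]),
        erase_eq_of_notMem (by simp [h])]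
      omega
  by_cases hZ0 : Z.Nonempty
  -- After the swap `i` inherits all private neighbours of `j`, so it dominates what `j` did.
  -- Putting `u` into `Y` whenever possible hands `u` to `j`, so that `j` itself stays dominated;
  -- there is room for `u` since `Z` is nonempty.
  · obtain ⟨Y, hsY, hYW, hYc⟩ : ∃ Y, (if u ∈ W then {u} else ∅) ⊆ Y ∧ Y ⊆ W ∧ Y.card = Z.card := by
      refine exists_subsuperset_card_eq ?_ ?_ hcard
      · split_ifs with h <;> simp [h]
      · have := card_pos.2 hZ0
        split_ifs with h <;> simp
        omega
    have hiS : i ∉ Z ∪ Y := by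
      rw [mem_union]; rintro (h | h)
      · exact ((hZ i).1 h).2.2 rfl
      · exact G.irrefl ((hW i).1 (hYW h)).1
    have hjS : j ∉ Z ∪ Y := by
      rw [mem_union]; rintro (h | h)
      · exact G.irrefl ((hZ j).1 h).1
      · exact ((hW j).1 (hYW h)).2.2 rfl
    refine ⟨swapOn G i j (Z ∪ Y) hiS hjS, i, hi, hlt,
      deg_swapOn hij (fun z hz => (hZ z).1 hz) (fun y hy => (hW y).1 (hYW hy)) hYc hiS hjS, ?_⟩
    have keep : ∀ a v, a ≠ i → a ≠ j → v ≠ i → v ≠ j → G.Adj a v →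
        (swapOn G i j (Z ∪ Y) hiS hjS).Adj a v := by
      intro a v h1 h2 h3 h4 h
      rw [swapOn_adj, Equiv.swap_apply_of_ne_of_ne h1 h2, Equiv.swap_apply_of_ne_of_ne h3 h4]
      simp [h]
    intro v hv
    simp only [mem_insert, mem_erase, not_or, not_and] at hv
    obtain ⟨hvi, hvD⟩ := hv
    by_cases hvj : v = j
    · subst hvj
      by_cases huj : u = v
      · refine ⟨i, mem_insert_self _ _, ?_⟩
        rw [swapOn_adj, if_neg hiS, if_neg hjS, ← huj]; exact hui.symm
      · refine ⟨u, by simp [huj, huD], ?_⟩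
        by_cases huv : G.Adj v u
        · have huS : u ∉ Z ∪ Y := by
            rw [mem_union]; rintro (h | h)
            · exact ((hZ u).1 h).2.1 hui.symm
            · exact ((hW u).1 (hYW h)).2.1 huv
          rw [swapOn_adj, if_neg huS, if_neg hjS]; exact huv.symm
        · have huW : u ∈ W := (hW u).2 ⟨hui.symm, huv, huj⟩
          have huY : u ∈ Z ∪ Y := mem_union_right _ (hsY (by simp [huW]))
          rw [swapOn_adj, if_pos huY, Equiv.swap_apply_right]; exact hui
    · have hvD' : v ∉ D := hvD hvj
      by_cases hvZ : v ∈ Z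
      · refine ⟨i, mem_insert_self _ _, ?_⟩
        rw [swapOn_adj, if_neg hiS, if_pos (mem_union_left _ hvZ), Equiv.swap_apply_left]
        exact ((hZ v).1 hvZ).1
      · obtain ⟨a, haD, hav⟩ := hD v hvD'
        by_cases haj : a = j
        · subst haj
          have hvY : v ∉ Y := fun h => ((hW v).1 (hYW h)).2.1 hav
          refine ⟨i, mem_insert_self _ _, ?_⟩
          rw [swapOn_adj, if_neg hiS, if_neg (by simp [hvZ, hvY])]
          by_contra h
          exact hvZ ((hZ v).2 ⟨hav, h, hvi⟩)
        · exact ⟨a, by simp [haj, haD],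
            keep a v (fun h => hi (h ▸ haD)) haj hvi hvj hav⟩
  -- Now `j` has no private neighbour, so `i` dominates everything that `j` dominates; only `j`
  -- itself may be left undominated by `D.erase j` together with `i`.
  · have hsub : ∀ v, G.Adj j v → v ≠ i → G.Adj i v := by
      intro v h1 h2
      by_contra h3
      exact hZ0 ⟨v, (hZ v).2 ⟨h1, h3, h2⟩⟩
    by_cases hdom : G.Adj i j ∨ ∃ a ∈ D.erase j, G.Adj a j
    · refine ⟨G, i, hi, hlt, fun _ => rfl, fun v hv => ?_⟩
      simp only [mem_insert, mem_erase, not_or, not_and] at hv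
      by_cases hvj : v = j
      · subst hvj
        rcases hdom with h | ⟨a, ha, h⟩
        · exact ⟨i, mem_insert_self _ _, h⟩
        · exact ⟨a, mem_insert_of_mem ha, h⟩
      · obtain ⟨a, haD, hav⟩ := hD v (hv.2 hvj)
        by_cases haj : a = j
        · exact ⟨i, mem_insert_self _ _, hsub v (haj ▸ hav) hv.1⟩
        · exact ⟨a, by simp [haj, haD], hav⟩
    · push Not at hdom
      obtain ⟨hnij, hnA⟩ := hdom
      have huj : u ≠ j := fun h => hnij (h ▸ hui).symm
      have huA : u ∈ D.erase j := mem_erase.2 ⟨huj, huD⟩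
      have hwD : ∀ w, G.Adj j w → w ∉ D := fun w hw h =>
        hnA w (mem_erase.2 ⟨hw.ne', h⟩) hw.symm
      have hwi : ∀ w, G.Adj j w → w ≠ i := fun w hw h => hnij (h ▸ hw).symm
      -- The switch of `u'i`, `wj` to `u'w`, `ij` lets `i` dominate `j` and `u'` dominate `w`.
      by_cases h2a : ∃ w u', G.Adj j w ∧ u' ∈ D.erase j ∧ G.Adj u' i ∧ ¬ G.Adj u' w
      · obtain ⟨w, u', hjw, hu', hu'i, hu'w⟩ := h2a
        have hne : u' ≠ w := fun h => hwD w hjw (h ▸ mem_of_mem_erase hu')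
        refine ⟨switch G u' i w j, i, hi, hlt,
          deg_switch hu'i hjw.symm hu'w hnij hne hij, fun v hv => ?_⟩
        have hv0 := hv
        simp only [mem_insert, mem_erase, not_or, not_and] at hv
        by_cases hvj : v = j
        · exact ⟨i, mem_insert_self _ _, by rw [switch_adj hne hij]; simp [hvj]⟩
        by_cases hvw : v = w
        · exact ⟨u', mem_insert_of_mem hu', by rw [switch_adj hne hij]; simp [hvw]⟩
        have hvu : v ≠ u' := fun h => hv0 (mem_insert_of_mem (h ▸ hu'))
        obtain ⟨a, haD, hav⟩ := hD v (hv.2 hvj)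
        by_cases haj : a = j
        · refine ⟨i, mem_insert_self _ _, ?_⟩
          rw [switch_adj hne hij]
          left
          refine ⟨hsub v (haj ▸ hav) hv.1, ?_, ?_⟩
          · grind
          · grind
        · refine ⟨a, by simp [haj, haD], ?_⟩
          rw [switch_adj hne hij]
          left
          refine ⟨hav, ?_, ?_⟩
          · grind
          · grind
      · push Not at h2a
        -- Here `u` is adjacent to all neighbours of `j`. The switch of `uw'`, `jw` to `uj`, `w'w`
        -- lets `u` dominate `j`, while `i` still dominates `w` and `w'`.
        by_cases h2b : ∃ w w', G.Adj j w ∧ G.Adj j w' ∧ w' ≠ w ∧ ¬ G.Adj w' w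
        · obtain ⟨w, w', hjw, hjw', hne, hnadj⟩ := h2b
          have huw' : G.Adj u w' := h2a w' u hjw' huA hui
          have hnuj : ¬ G.Adj u j := hnA u huA
          refine ⟨switch G u w' j w, i, hi, hlt,
            deg_switch huw' hjw hnuj hnadj huj hne, fun v hv => ?_⟩
          have hv0 := hv
          simp only [mem_insert, mem_erase, not_or, not_and] at hv
          have hui' := hui.ne
          have hwi1 := hwi w hjw
          have hwi2 := hwi w' hjw'
          have hwD1 := hwD w hjw
          have hwD2 := hwD w' hjw'
          by_cases hvj : v = j
          · exact ⟨u, mem_insert_of_mem huA, by rw [switch_adj huj hne]; simp [hvj]⟩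
          have hvu : v ≠ u := fun h => hv0 (mem_insert_of_mem (h ▸ huA))
          by_cases hvw : v = w'
          · refine ⟨i, mem_insert_self _ _, ?_⟩
            rw [switch_adj huj hne]
            left
            subst hvw
            refine ⟨hsub v hjw' hv.1, ?_, ?_⟩
            · grind
            · grind
          obtain ⟨a, haD, hav⟩ := hD v (hv.2 hvj)
          by_cases haj : a = j
          · refine ⟨i, mem_insert_self _ _, ?_⟩
            rw [switch_adj huj hne]
            left
            refine ⟨hsub v (haj ▸ hav) hv.1, ?_, ?_⟩
            · grind
            · grind
          · refine ⟨a, by simp [haj, haD], ?_⟩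
            rw [switch_adj huj hne]
            left
            refine ⟨hav, ?_, ?_⟩
            · grind
            · grind
        · push Not at h2b
          -- What remains: the neighbours of `j` form a clique, all joined to `i` and `u`. Each of
          -- them has degree at least `deg G j + 2` and can replace `j` without any change of the
          -- graph, since `u` dominates the other neighbours of `j`.
          obtain ⟨w, hjw⟩ := deg_pos_iff.1 hpos
          refine ⟨G, w, hwD w hjw, ?_, fun _ => rfl, fun v hv => ?_⟩
          · have hiw := hsub w hjw (hwi w hjw)
            have huw := h2a w u hjw huA hui
            have hsubset : insert j (insert i (insert u ((nbr G j).erase w))) ⊆ nbr G w := by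
              intro x hx
              simp only [mem_insert, mem_erase, mem_nbr] at hx ⊢
              rcases hx with rfl | rfl | rfl | ⟨h1, h2⟩
              · exact hjw.symm
              · exact hiw.symm
              · exact huw.symm
              · exact h2b x w h2 hjw h1.symm
            have hc := card_le_card hsubset
            rw [card_insert_of_notMem, card_insert_of_notMem, card_insert_of_notMem,
              card_erase_of_mem (by simpa using hjw)] at hc
            · unfold deg; omega
            · simp only [mem_erase, mem_nbr, not_and]
              exact fun _ h => hnA u huA h.symm
            · simp only [mem_insert, mem_erase, mem_nbr, not_or, not_and]
              exact ⟨hui.ne', fun _ h => hnij h.symm⟩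
            · simp only [mem_insert, mem_erase, mem_nbr, not_or, not_and]
              exact ⟨hij.symm, huj.symm, fun _ h => G.irrefl h⟩
          · simp only [mem_insert, mem_erase, not_or, not_and] at hv
            by_cases hvj : v = j
            · exact ⟨w, mem_insert_self _ _, hvj ▸ hjw.symm⟩
            obtain ⟨a, haD, hav⟩ := hD v (hv.2 hvj)
            by_cases haj : a = j
            · exact ⟨u, mem_insert_of_mem huA, h2a v u (haj ▸ hav) huA hui⟩
            · exact ⟨a, by simp [haj, haD], hav⟩

theorem deg_comap (G : SimpleGraph (Fin n)) (σ : Equiv.Perm (Fin n)) (v : Fin n) :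
    deg (G.comap σ) v = deg G (σ v) := by
  unfold deg
  refine card_bij' (fun b _ => σ b) (fun b _ => σ.symm b) ?_ ?_ ?_ ?_ <;> simp

theorem eq_filter_of_isLowerSet {D : Finset (Fin n)} (h : ∀ i j, i ∉ D → j ∈ D → ¬ i < j) :
    D = univ.filter fun v : Fin n => v.val < D.card := by
  ext v
  simp only [mem_filter, mem_univ, true_and]
  constructor
  · intro hv
    have : Iic v ⊆ D := fun w hw => by
      by_contra hwD
      rcases (mem_Iic.1 hw).lt_or_eq with h' | h'
      · exact h w v hwD hv h'
      · exact hwD (h' ▸ hv)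
    have := card_le_card this
    rw [Fin.card_Iic] at this
    omega
  · intro hv
    by_contra hvD
    have : D ⊆ Iio v := fun w hw => by
      rw [mem_Iio]
      by_contra hwv
      rcases (not_lt.1 hwv).lt_or_eq with h' | h'
      · exact h v w hvD hw h'
      · exact hvD (h' ▸ hw)
    have := card_le_card this
    rw [Fin.card_Iio] at this
    omega

theorem card_insert_erase {D : Finset (Fin n)} {x j : Fin n} (hx : x ∉ D) (hj : j ∈ D) :
    (insert x (D.erase j)).card = D.card := by
  rw [card_insert_of_notMem (fun h => hx (mem_of_mem_erase h)), card_erase_of_mem hj]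
  have := card_pos.2 ⟨j, hj⟩
  omega

/-- Some realization is dominated by the vertices of the highest degrees. -/
theorem exists_isDominatingSet_initial {d : Fin n → ℕ} (hd : Antitone d) (hpos : ∀ i, 0 < d i)
    (N : ℕ) : ∀ (G : SimpleGraph (Fin n)) (D : Finset (Fin n)), (∀ v, deg G v = d v) →
      IsDominatingSet G D → ∑ v ∈ D, v.val = N →
      ∃ G' : SimpleGraph (Fin n), (∀ v, deg G' v = d v) ∧
        IsDominatingSet G' (univ.filter fun v : Fin n => v.val < D.card) := by
  -- Every exchange puts a smaller index into `D`, so the sum of the indices drops.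
  induction N using Nat.strong_induction_on with
  | _ N ih =>
    intro G D hG hD hN
    by_cases hlow : ∀ i j, i ∉ D → j ∈ D → ¬ i < j
    · refine ⟨G, hG, ?_⟩
      rw [← eq_filter_of_isLowerSet hlow]
      exact hD
    · push Not at hlow
      obtain ⟨i, j, hi, hj, hlt⟩ := hlow
      have hstep : ∃ (G' : SimpleGraph (Fin n)) (x : Fin n), x ∉ D ∧ x < j ∧
          (∀ v, deg G' v = d v) ∧ IsDominatingSet G' (insert x (D.erase j)) := by
        rcases (hd hlt.le).lt_or_eq with h | h
        · obtain ⟨G', x, hx, hdx, hdeg, hdom⟩ := exists_exchange hD hi hj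
            (by rw [hG, hG]; exact h) (by rw [hG]; exact hpos j)
          refine ⟨G', x, hx, ?_, fun v => by rw [hdeg, hG], hdom⟩
          rw [hG, hG] at hdx
          by_contra hle
          exact absurd (hd (not_lt.1 hle)) (not_le.2 hdx)
        -- For equal degrees, relabelling by the transposition of `i` and `j` again gives a
        -- realization.
        · refine ⟨G.comap (Equiv.swap i j), i, hi, hlt, fun v => ?_, fun v hv => ?_⟩
          · rw [deg_comap, hG]
            by_cases h1 : v = i
            · subst h1; rw [Equiv.swap_apply_left, h]
            by_cases h2 : v = j
            · subst h2; rw [Equiv.swap_apply_right, h]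
            rw [Equiv.swap_apply_of_ne_of_ne h1 h2]
          · simp only [mem_insert, mem_erase, not_or, not_and] at hv
            have hσ : Equiv.swap i j v ∉ D := by
              by_cases h2 : v = j
              · subst h2; rwa [Equiv.swap_apply_right]
              rw [Equiv.swap_apply_of_ne_of_ne hv.1 h2]
              exact hv.2 h2
            obtain ⟨a, haD, hav⟩ := hD _ hσ
            refine ⟨Equiv.swap i j a, ?_, by simpa using hav⟩
            by_cases haj : a = j
            · subst haj; simp
            · have hai : a ≠ i := fun h => hi (h ▸ haD)
              rw [Equiv.swap_apply_of_ne_of_ne hai haj]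
              simp [haj, haD]
      obtain ⟨G', x, hx, hxj, hdeg, hdom⟩ := hstep
      have hsum : ∑ v ∈ insert x (D.erase j), v.val < N := by
        rw [sum_insert (fun h => hx (mem_of_mem_erase h)), ← hN, ← add_sum_erase D _ hj]
        have : x.val < j.val := hxj
        omega
      have := ih _ hsum G' _ hdeg hdom rfl
      rwa [card_insert_erase hx hj] at this

end Exchange

/-! ### States, and when they come from realizations. -/

section State

variable {V : Type*} [Fintype V] [DecidableEq V]

/-- The degree data of a realization dominated by `D`: a graph `H` on the complement of `D` and
the numbers `e v ≥ 1` of edges from `v ∉ D` to `D`, where `m` edges are left inside `D`. -/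
structure IsState (d : V → ℕ) (D : Finset V) (m : ℕ) (H : SimpleGraph V) (e : V → ℕ) : Prop where
  supp : ∀ v w, H.Adj v w → v ∉ D
  deg_add : ∀ v, v ∉ D → deg H v + e v = d v
  pos : ∀ v, v ∉ D → 1 ≤ e v
  le : ∀ v, v ∉ D → e v ≤ D.card
  sum : ∑ v ∈ Dᶜ, e v + 2 * m = ∑ i ∈ D, d i
  two_le : 2 * m ≤ D.card * (D.card - 1)

variable {d : V → ℕ} {D : Finset V} {m : ℕ} {H : SimpleGraph V} {e : V → ℕ}

/-- The vertices outside `D` with at least two edges to `D`. -/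
def multi (D : Finset V) (e : V → ℕ) : Finset V := Dᶜ.filter fun v => 2 ≤ e v

/-- The vertices outside `D` that are joined to all of `D`. -/
def saturated (D : Finset V) (e : V → ℕ) : Finset V := Dᶜ.filter fun v => e v = D.card

theorem mem_multi {v : V} : v ∈ multi D e ↔ v ∉ D ∧ 2 ≤ e v := by simp [multi]

theorem mem_saturated {v : V} : v ∈ saturated D e ↔ v ∉ D ∧ e v = D.card := by simp [saturated]

theorem sum_ite_eq_card {S : Finset V} {u : V} (hu : u ∈ S) :
    ∑ v ∈ S, (if v = u then 1 else 0) = 1 := by simp [hu]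

/-- Each of `u` and `w` trades one edge to `D` for the edge `uw`; the two edge ends that become free
in `D` are accounted for by one more edge inside `D`. Membership in `multi` keeps both numbers
positive. -/
theorem IsState.addEdge (hs : IsState d D m H e) {u w : V} (hne : u ≠ w) (hadj : ¬ H.Adj u w)
    (hu : u ∈ multi D e) (hw : w ∈ multi D e) (hm : 2 * (m + 1) ≤ D.card * (D.card - 1)) :
    IsState d D (m + 1) (addEdge H u w)
      (fun v => e v - (if v = u then 1 else 0) - (if v = w then 1 else 0)) := by
  rw [mem_multi] at hu hw
  refine ⟨?_, ?_, ?_, ?_, ?_, hm⟩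
  · intro v x h
    rw [addEdge_adj hne] at h
    rcases h with h | ⟨rfl, -⟩ | ⟨rfl, -⟩
    · exact hs.supp v x h
    · exact hu.1
    · exact hw.1
  · intro v hv
    have := hs.deg_add v hv
    have := hs.pos v hv
    rw [deg_addEdge hne hadj]
    split_ifs <;> grind
  · intro v hv
    have := hs.pos v hv
    show 1 ≤ _
    split_ifs <;> grind
  · intro v hv
    have := hs.le v hv
    show _ ≤ D.card
    omega
  · have h1 : ∑ v ∈ Dᶜ, (e v - (if v = u then 1 else 0) - (if v = w then 1 else 0)) +
        (∑ v ∈ Dᶜ, (if v = u then 1 else 0) + ∑ v ∈ Dᶜ, (if v = w then 1 else 0)) =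
        ∑ v ∈ Dᶜ, e v := by
      rw [← sum_add_distrib, ← sum_add_distrib]
      refine sum_congr rfl fun v hv => ?_
      have := hs.pos v (by simpa using hv)
      split_ifs <;> grind
    rw [sum_ite_eq_card (by simpa using hu.1), sum_ite_eq_card (by simpa using hw.1)] at h1
    have := hs.sum
    omega

/-- The reverse trade: an edge inside `D` is given up, and `p` and `q` each get an edge to `D`
instead of `pq`. -/
theorem IsState.delEdge (hs : IsState d D m H e) {p q : V} (hadj : H.Adj p q)
    (hp : e p < D.card) (hq : e q < D.card) (hm : 1 ≤ m) :
    IsState d D (m - 1) (delEdge H p q)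
      (fun v => e v + (if v = p then 1 else 0) + (if v = q then 1 else 0)) := by
  have hpq := hadj.ne
  have hpD := hs.supp _ _ hadj
  have hqD := hs.supp _ _ hadj.symm
  refine ⟨?_, ?_, ?_, ?_, ?_, ?_⟩
  · intro v x h
    rw [delEdge_adj] at h
    exact hs.supp v x h.1
  · intro v hv
    have := hs.deg_add v hv
    have := deg_delEdge hadj v
    show _ + (_ + _ + _) = _
    omega
  · intro v hv
    have := hs.pos v hv
    show 1 ≤ _
    omega
  · intro v hv
    have := hs.le v hv
    show _ ≤ D.card
    split_ifs <;> grind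
  · rw [sum_add_distrib, sum_add_distrib, sum_ite_eq_card (by simpa using hpD),
      sum_ite_eq_card (by simpa using hqD)]
    have := hs.sum
    omega
  · have := hs.two_le
    omega

/-- When `q` changes its neighbour from `p` to `u`, the vertex `p` needs one more edge to `D` and
`u` one fewer, so `m` stays the same. -/
theorem IsState.moveEdge (hs : IsState d D m H e) {p q u : V} (hadj : H.Adj p q)
    (hnadj : ¬ H.Adj u q) (huq : u ≠ q) (hu : u ∈ multi D e) (hp : e p < D.card) :
    IsState d D m (moveEdge H p u q)
      (fun v => e v + (if v = p then 1 else 0) - (if v = u then 1 else 0)) := by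
  have hpu : p ≠ u := fun h => hnadj (h ▸ hadj)
  have hpD := hs.supp _ _ hadj
  have hqD := hs.supp _ _ hadj.symm
  rw [mem_multi] at hu
  refine ⟨?_, ?_, ?_, ?_, ?_, hs.two_le⟩
  · intro v x h
    rw [moveEdge_adj huq] at h
    rcases h with h | ⟨rfl, -⟩ | ⟨rfl, -⟩
    · exact hs.supp v x h.1
    · exact hu.1
    · exact hqD
  · intro v hv
    have := hs.deg_add v hv
    have := hs.pos v hv
    have := deg_moveEdge hadj hnadj huq v
    show _ + (_ + _ - _) = _
    split_ifs at * <;> grind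
  · intro v hv
    have := hs.pos v hv
    show 1 ≤ _
    split_ifs <;> grind
  · intro v hv
    have := hs.le v hv
    show _ ≤ D.card
    split_ifs <;> grind
  · have h1 : ∑ v ∈ Dᶜ, (e v + (if v = p then 1 else 0) - (if v = u then 1 else 0)) +
        ∑ v ∈ Dᶜ, (if v = u then 1 else 0) = ∑ v ∈ Dᶜ, e v + ∑ v ∈ Dᶜ, (if v = p then 1 else 0) := by
      rw [← sum_add_distrib, ← sum_add_distrib]
      refine sum_congr rfl fun v hv => ?_
      have := hs.pos v (by simpa using hv)
      split_ifs <;> grind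
    rw [sum_ite_eq_card (by simpa using hu.1), sum_ite_eq_card (by simpa using hpD)] at h1
    have := hs.sum
    omega

/-- Join the vertex `c` to the set `C`. -/
def addStar (H : SimpleGraph V) (c : V) (C : Finset V) (hc : c ∉ C) : SimpleGraph V where
  Adj a b := H.Adj a b ∨ (a = c ∧ b ∈ C) ∨ (b = c ∧ a ∈ C)
  symm := ⟨by
    intro a b h
    rcases h with h | h | h
    · exact Or.inl h.symm
    · exact Or.inr (Or.inr h)
    · exact Or.inr (Or.inl h)⟩
  loopless := ⟨by
    intro a h
    rcases h with h | ⟨rfl, h⟩ | ⟨rfl, h⟩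
    · exact H.irrefl h
    · exact hc h
    · exact hc h⟩

/-- A vertex `c ∈ D` is moved out of `D`: the edges from `C` to `D` are turned into edges
to `c`. -/
theorem IsState.erase (hs : IsState d D m H e) {c : V} (hc : c ∈ D) {C : Finset V}
    (hsat : saturated D e ⊆ C) (hC : C ⊆ multi D e) {t : ℕ} (hcard : C.card + t = d c)
    (ht : 1 ≤ t) (htm : t ≤ m) (htk : t ≤ D.card - 1)
    (hm : 2 * (m - t) ≤ (D.card - 1) * (D.card - 1 - 1)) :
    ∃ H' e', IsState d (D.erase c) (m - t) H' e' := by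
  have hcC : c ∉ C := fun h => (mem_multi.1 (hC h)).1 hc
  have hadj : ∀ v, ¬ H.Adj c v := fun v h => hs.supp c v h hc
  -- Outside the new set, `c` has `t` edges to `D.erase c` and is joined to `C`. Taking all
  -- saturated vertices into `C` brings their numbers down to the new size of the set, and `C ⊆
  -- multi D e` keeps them positive.
  refine ⟨addStar H c C hcC, fun v => if v = c then t else if v ∈ C then e v - 1 else e v,
    ?_, ?_, ?_, ?_, ?_, ?_⟩
  · intro v w h
    rw [mem_erase]
    rcases h with h | ⟨rfl, h⟩ | ⟨rfl, h⟩
    · exact fun h' => hs.supp v w h h'.2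
    · exact fun h' => h'.1 rfl
    · exact fun h' => (mem_multi.1 (hC h)).1 h'.2
  · intro v hv
    by_cases hvc : v = c
    · subst hvc
      have : nbr (addStar H v C hcC) v = C := by
        ext x
        simp only [mem_nbr, addStar, hadj]
        grind
      rw [deg, this]
      simpa using hcard
    · have hvD : v ∉ D := fun h => hv (mem_erase.2 ⟨hvc, h⟩)
      have h1 := hs.deg_add v hvD
      have h2 := hs.pos v hvD
      by_cases hvC : v ∈ C
      · have : nbr (addStar H c C hcC) v = insert c (nbr H v) := by
          ext x
          simp only [mem_nbr, addStar, mem_insert]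
          grind
        rw [deg, this, card_insert_of_notMem (by simpa using fun h => hadj v (H.adj_symm h))]
        simp only [hvc, hvC, if_true, if_false]
        unfold deg at h1
        omega
      · have : nbr (addStar H c C hcC) v = nbr H v := by
          ext x
          simp only [mem_nbr, addStar]
          grind
        rw [deg, this]
        simp only [hvc, hvC, if_false]
        unfold deg at h1
        exact h1
  · intro v hv
    by_cases hvc : v = c
    · simpa [hvc] using ht
    · have hvD : v ∉ D := fun h => hv (mem_erase.2 ⟨hvc, h⟩)
      have := hs.pos v hvD
      by_cases hvC : v ∈ C
      · have := (mem_multi.1 (hC hvC)).2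
        simp only [hvc, hvC, if_true, if_false]
        omega
      · simpa only [hvc, hvC, if_false] using this
  · intro v hv
    rw [card_erase_of_mem hc]
    by_cases hvc : v = c
    · simpa [hvc] using htk
    · have hvD : v ∉ D := fun h => hv (mem_erase.2 ⟨hvc, h⟩)
      have h1 := hs.le v hvD
      by_cases hvC : v ∈ C
      · simp only [hvc, hvC, if_true, if_false]
        omega
      · have : e v ≠ D.card := fun h => hvC (hsat (mem_saturated.2 ⟨hvD, h⟩))
        simp only [hvc, hvC, if_false]
        omega
  · have hcompl : (D.erase c)ᶜ = insert c Dᶜ := by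
      ext x; simp only [mem_compl, mem_erase, mem_insert]; tauto
    rw [hcompl, sum_insert (by simpa using hc)]
    simp only [if_true]
    have h1 : ∑ v ∈ Dᶜ, (if v = c then t else if v ∈ C then e v - 1 else e v) + C.card =
        ∑ v ∈ Dᶜ, e v := by
      have hCD : C = Dᶜ.filter (· ∈ C) := by
        ext x
        simp only [mem_filter, mem_compl]
        exact ⟨fun h => ⟨(mem_multi.1 (hC h)).1, h⟩, fun h => h.2⟩
      conv_lhs => rw [hCD, card_filter, ← hCD, ← sum_add_distrib]
      refine sum_congr rfl fun v hv => ?_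
      have hvc : v ≠ c := fun h => (mem_compl.1 hv) (h ▸ hc)
      have := hs.pos v (by simpa using hv)
      simp only [hvc, if_false]
      split_ifs <;> omega
    have h2 := hs.sum
    rw [← add_sum_erase D _ hc] at h2
    omega
  · rw [card_erase_of_mem hc]
    exact hm

theorem exists_not_adj {S : Finset V} {v : V} (hv : v ∈ S) (h : deg H v + 1 < S.card) :
    ∃ u ∈ S, ∃ w ∈ S, u ≠ w ∧ ¬ H.Adj u w := by
  by_contra hcon
  push Not at hcon
  have hsub : S.erase v ⊆ nbr H v := fun x hx => by
    rw [mem_nbr]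
    exact hcon v hv x (mem_of_mem_erase hx) (ne_of_mem_erase hx).symm
  have := card_le_card hsub
  rw [card_erase_of_mem hv] at this
  unfold deg at h
  omega

/-- A state with many vertices outside `D` that have two edges to `D` yields a state for a
smaller set, or one with fewer edges inside `D`. -/
theorem descent (hreal : ∃ G : SimpleGraph V, ∀ v, deg G v = d v) {c : V} (hc : c ∈ D)
    (hmax : ∀ v, v ∉ D → d v ≤ d c) (hcpos : 1 ≤ d c) (hk : 2 ≤ D.card) (N : ℕ) :
    ∀ (m : ℕ) (H : SimpleGraph V) (e : V → ℕ), IsState d D m H e → 1 ≤ m →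
      d c ≤ (multi D e).card + min m (D.card - 1) → ∑ v ∈ Dᶜ, e v ^ 2 = N →
      (∃ m' H' e', IsState d (D.erase c) m' H' e') ∨
        (2 ≤ m ∧ d c < D.card - 1 ∧ ∃ H' e', IsState d D (m - 1) H' e') := by
  -- The induction is on the sum of squares of `e`, which falls when saturated vertices give up
  -- edges to `D`.
  induction N using Nat.strong_induction_on with
  | _ N ih =>
  intro m H e hs hm hY hN
  obtain ⟨q, hq⟩ : ∃ q, D.card = q + 1 := ⟨D.card - 1, by omega⟩
  have hq1 : 1 ≤ q := by omega
  have hkq : D.card * (D.card - 1) = q * (q - 1) + 2 * q := by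
    rw [hq]; obtain ⟨s, rfl⟩ : ∃ s, q = s + 1 := ⟨q - 1, by omega⟩
    simp only [Nat.add_sub_cancel]; ring
  have h2 := hs.two_le
  -- The number of edges that `c` keeps to the rest of `D` when it leaves, as large as possible.
  set t := min (min m q) (d c) with ht
  have hsm : saturated D e ⊆ multi D e := fun v hv => by
    rw [mem_saturated] at hv
    exact mem_multi.2 ⟨hv.1, by omega⟩
  have hEG : ∑ i ∈ D.erase c, d i ≤ q * (q - 1) + (min (d c) q + ∑ v ∈ Dᶜ, min (d v) q) := by
    obtain ⟨G, hG⟩ := hreal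
    have h := sum_deg_le G (D.erase c)
    have hcompl : (D.erase c)ᶜ = insert c Dᶜ := by
      ext x; simp only [mem_compl, mem_erase, mem_insert]; tauto
    rw [card_erase_of_mem hc, hcompl, sum_insert (by simpa using hc)] at h
    simp only [hG, hq, Nat.add_sub_cancel] at h
    exact h
  have hsum := hs.sum
  rw [← add_sum_erase D _ hc] at hsum
  by_cases hX : (saturated D e).card + t ≤ d c
  · by_cases hmt : 2 * (m - t) ≤ q * (q - 1)
    · left
      obtain ⟨C, hXC, hCY, hCc⟩ := exists_subsuperset_card_eq (n := d c - t) hsm (by omega)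
        (by rw [hq] at hY; simp only [Nat.add_sub_cancel] at hY; omega)
      obtain ⟨H', e', h'⟩ := hs.erase hc hXC hCY (t := t) (by omega) (by omega) (by omega)
        (by omega) (by rw [hq]; simpa using hmt)
      exact ⟨_, H', e', h'⟩
    -- Too many edges inside `D` would be left without `c`. This forces `t = d c < q`, so no vertex
    -- outside `D` is saturated, and turning an edge of `H` into edges to `D` lowers `m`. If `H` has
    -- no edge, then `e = d` outside `D`, which contradicts Erdős–Gallai.
    · right
      have htm : t ≠ m := fun h => hmt (by rw [h]; simp)
      have htq : t ≠ q := fun h => hmt (by omega)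
      have hdc : d c < q := by omega
      refine ⟨by omega, by omega, ?_⟩
      by_cases hedge : ∃ a b, H.Adj a b
      · obtain ⟨a, b, hab⟩ := hedge
        have key : ∀ x, x ∉ D → e x < D.card := fun x hx => by
          have := hs.deg_add x hx
          have := hmax x hx
          omega
        exact ⟨_, _, hs.delEdge hab (key a (hs.supp _ _ hab)) (key b (hs.supp _ _ hab.symm)) hm⟩
      · exfalso
        push Not at hedge
        have h3 : ∑ v ∈ Dᶜ, min (d v) q ≤ ∑ v ∈ Dᶜ, e v := by
          refine sum_le_sum fun v hv => ?_
          have h4 := hs.deg_add v (by simpa using hv)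
          have h5 : deg H v = 0 := by
            by_contra h
            obtain ⟨w, hw⟩ := deg_pos_iff.1 (Nat.pos_of_ne_zero h)
            exact hedge v w hw
          omega
        omega
  · have hXpos : 0 < (saturated D e).card := by omega
    obtain ⟨x, hx⟩ := card_pos.1 hXpos
    have hkc : D.card ≤ d c := by
      have h3 := mem_saturated.1 hx
      have := hs.deg_add x h3.1
      have := hmax x h3.1
      omega
    have hdegX : ∀ u ∈ saturated D e, deg H u + D.card ≤ d c := fun u hu => by
      have h3 := mem_saturated.1 hu
      have := hs.deg_add u h3.1
      have := hmax u h3.1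
      omega
    -- There are more saturated vertices than `c` can be joined to. They are too many to be pairwise
    -- adjacent in `H`, so as long as an edge inside `D` can be added, two of them are joined to
    -- each other instead of to `D`.
    by_cases hfull : 2 * (m + 1) ≤ D.card * (D.card - 1)
    · obtain ⟨u, hu, w, hw, huw, hnadj⟩ := exists_not_adj (H := H) hx (by
        have := hdegX x hx; omega)
      have hk3 : 3 ≤ D.card := by
        by_contra h
        have : D.card = 2 := by omega
        rw [this] at hfull
        omega
      have hu' := mem_saturated.1 hu
      have hw' := mem_saturated.1 hw
      have hs' := hs.addEdge huw hnadj (hsm hu) (hsm hw) hfull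
      have hlt : ∑ v ∈ Dᶜ, (e v - (if v = u then 1 else 0) - (if v = w then 1 else 0)) ^ 2 < N := by
        rw [← hN]
        refine sum_lt_sum (fun v _ => Nat.pow_le_pow_left (by omega) 2) ⟨u, by simpa using hu'.1, ?_⟩
        refine Nat.pow_lt_pow_left ?_ (by norm_num)
        simp only [if_true]
        omega
      have hYeq : multi D e ⊆
          multi D (fun v => e v - (if v = u then 1 else 0) - (if v = w then 1 else 0)) := by
        intro v hv
        rw [mem_multi] at hv ⊢
        refine ⟨hv.1, ?_⟩
        show 2 ≤ _
        split_ifs <;> grind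
      have hYc := card_le_card hYeq
      rcases ih _ hlt _ _ _ hs' (by omega) (by omega) rfl with h | h
      · exact Or.inl h
      -- The second outcome needs `d c < D.card - 1`, but a saturated vertex shows `D.card ≤ d c`.
      -- So the change of `m` in the recursion does no harm.
      · exact absurd h.2.1 (by omega)
    · have hpar : 2 * m = D.card * (D.card - 1) := by
        have : Even (D.card * (D.card - 1)) := Nat.even_mul_pred_self _
        obtain ⟨s, hs⟩ := this
        omega
      have hmq : q ≤ m := by
        have : 2 * q ≤ 2 * m := by rw [hpar, hkq]; omega
        omega
      have hXq : d c < (saturated D e).card + q := by omega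
      -- Now `D` is to be complete. An edge of `H` at a vertex `p` with `e p ≤ D.card - 2` may be
      -- moved to a saturated vertex: the two numbers approach each other, so the sum of squares
      -- drops.
      by_cases hroom : ∃ p, p ∉ D ∧ e p + 2 ≤ D.card ∧ ∃ b, H.Adj p b
      · by_cases hmove : ∃ p b u, p ∉ D ∧ e p + 2 ≤ D.card ∧ H.Adj p b ∧ u ∈ saturated D e ∧
            u ≠ b ∧ ¬ H.Adj u b
        · obtain ⟨p, b, u, hpD, hpk, hpb, hu, hub, hnub⟩ := hmove
          have hu' := mem_saturated.1 hu
          have hpu : p ≠ u := fun h => hnub (h ▸ hpb)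
          have hs' := hs.moveEdge hpb hnub hub (hsm hu) (by omega)
          have hlt : ∑ v ∈ Dᶜ, (e v + (if v = p then 1 else 0) - (if v = u then 1 else 0)) ^ 2
              < N := by
            have hpm : p ∈ Dᶜ := by simpa using hpD
            have hum : u ∈ Dᶜ.erase p := by simpa using ⟨hpu.symm, hu'.1⟩
            rw [← hN, ← add_sum_erase _ _ hpm, ← add_sum_erase _ _ hum,
              ← add_sum_erase _ (fun v => e v ^ 2) hpm, ← add_sum_erase _ (fun v => e v ^ 2) hum]
            have hrest : ∑ v ∈ (Dᶜ.erase p).erase u,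
                (e v + (if v = p then 1 else 0) - (if v = u then 1 else 0)) ^ 2 =
                ∑ v ∈ (Dᶜ.erase p).erase u, e v ^ 2 := by
              refine sum_congr rfl fun v hv => ?_
              simp only [mem_erase] at hv
              simp [hv.1, hv.2.1]
            rw [hrest]
            simp only [if_true, if_neg hpu, if_neg hpu.symm, hu'.2, hq, Nat.add_sub_cancel,
              Nat.add_zero, Nat.sub_zero]
            have : e p + 1 ≤ q := by omega
            nlinarith
          have hYeq : multi D e ⊆
              multi D (fun v => e v + (if v = p then 1 else 0) - (if v = u then 1 else 0)) := by
            intro v hv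
            have hppos := hs.pos p hpD
            rw [mem_multi] at hv ⊢
            refine ⟨hv.1, ?_⟩
            show 2 ≤ _
            split_ifs <;> grind
          have hYc := card_le_card hYeq
          rcases ih _ hlt _ _ _ hs' (by omega) (by omega) rfl with h | h
          · exact Or.inl h
          · exact absurd h.2.1 (by omega)
        · exfalso
          push Not at hmove
          -- No move is possible, so a neighbour `b` of such a `p` is adjacent to `p` and to every
          -- other saturated vertex. Because `d b ≤ d c`, so many neighbours leave `b` at most
          -- `D.card - 2` edges to `D`.
          have key : ∀ p b, p ∉ D → e p + 2 ≤ D.card → H.Adj p b →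
              b ∉ saturated D e ∧ e b + 2 ≤ D.card := by
            intro p b hpD hpk hpb
            have hpX : p ∉ saturated D e := fun h => by
              have := (mem_saturated.1 h).2; omega
            have hsub : insert p ((saturated D e).erase b) ⊆ nbr H b := by
              intro u hu
              rw [mem_nbr]
              rcases mem_insert.1 hu with rfl | hu
              · exact hpb.symm
              · exact (hmove p b u hpD hpk hpb (mem_of_mem_erase hu) (ne_of_mem_erase hu)).symm
            have hcd := card_le_card hsub
            rw [card_insert_of_notMem (fun h => hpX (mem_of_mem_erase h))] at hcd
            have hbD := hs.supp _ _ hpb.symm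
            have h3 := hs.deg_add b hbD
            have h4 := hmax b hbD
            unfold deg at h3
            by_cases hb : b ∈ saturated D e
            · rw [card_erase_of_mem hb] at hcd
              have := (mem_saturated.1 hb).2
              omega
            · rw [erase_eq_of_notMem hb] at hcd
              exact ⟨hb, by omega⟩
          obtain ⟨p, hpD, hpk, b, hpb⟩ := hroom
          obtain ⟨hb1, hb2⟩ := key p b hpD hpk hpb
          -- By `key` the vertex `b` is of the same kind as `p`, so the saturated `x` is adjacent to
          -- `p`; applied to the edge `px`, `key` says that `x` is not saturated.
          have hxp : H.Adj x p := hmove b p x (hs.supp _ _ hpb.symm) hb2 hpb.symm hx (fun h => by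
            have := (mem_saturated.1 hx).2
            rw [h] at this
            omega)
          exact (key p x hpD hpk hxp.symm).1 hx
      · exfalso
        push Not at hroom
        -- A vertex with `e v ≤ q - 1` has no edge in `H`, so `e v = d v`; the others have `e v ≥
        -- q`, and the saturated ones `q + 1`. With `D` complete, this exceeds the Erdős–Gallai
        -- bound.
        have h3 : ∑ v ∈ Dᶜ, min (d v) q + (saturated D e).card ≤ ∑ v ∈ Dᶜ, e v := by
          rw [saturated, card_filter, ← sum_add_distrib]
          refine sum_le_sum fun v hv => ?_
          have hvD : v ∉ D := by simpa using hv
          have h4 := hs.deg_add v hvD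
          have h5 := hs.le v hvD
          by_cases hve : e v + 2 ≤ D.card
          · have h6 : deg H v = 0 := by
              by_contra h
              obtain ⟨w, hw⟩ := deg_pos_iff.1 (Nat.pos_of_ne_zero h)
              exact hroom v hvD hve w hw
            rw [if_neg (by omega)]
            omega
          · split_ifs <;> omega
        omega

/-- A graph with `m` edges inside `D`. -/
theorem exists_graph_on (D : Finset V) (m : ℕ) (hm : 2 * m ≤ D.card * (D.card - 1)) :
    ∃ K : SimpleGraph V, (∀ a b, K.Adj a b → a ∈ D) ∧ ∑ i ∈ D, deg K i = 2 * m ∧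
      ∀ i, deg K i ≤ m := by
  induction m with
  | zero =>
    refine ⟨⊥, fun a b h => absurd h (by simp), ?_, ?_⟩
    · simp [deg, nbr]
    · simp [deg, nbr]
  | succ m ih =>
    obtain ⟨K, h1, h2, h3⟩ := ih (by omega)
    have : ∃ u ∈ D, ∃ w ∈ D, u ≠ w ∧ ¬ K.Adj u w := by
      by_contra hcon
      push Not at hcon
      have hge : D.card * (D.card - 1) ≤ ∑ i ∈ D, deg K i := by
        rw [← smul_eq_mul]
        refine card_nsmul_le_sum _ _ _ fun i hi => ?_
        rw [← card_erase_of_mem hi]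
        refine card_le_card fun j hj => ?_
        rw [mem_nbr]
        exact hcon i hi j (mem_of_mem_erase hj) (ne_of_mem_erase hj).symm
      omega
    obtain ⟨u, hu, w, hw, huw, hn⟩ := this
    refine ⟨addEdge K u w, ?_, ?_, ?_⟩
    · intro a b h
      rw [addEdge_adj huw] at h
      rcases h with h | ⟨rfl, -⟩ | ⟨rfl, -⟩
      · exact h1 a b h
      · exact hu
      · exact hw
    · simp only [deg_addEdge huw hn]
      rw [sum_add_distrib, sum_add_distrib, sum_ite_eq_card hu, sum_ite_eq_card hw]
      omega
    · intro i
      rw [deg_addEdge huw hn]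
      have := h3 i
      split_ifs <;> grind

/-- Hands out the vertices with a single edge to `D`: one at a time, each goes to any member of `D`
with capacity left. Since the total capacity is the number of vertices, all capacities are met
exactly. -/
theorem exists_fiber_card (D : Finset V) (L : Finset V) : ∀ cap : V → ℕ,
    ∑ i ∈ D, cap i = L.card →
      ∃ f : V → V, (∀ v ∈ L, f v ∈ D) ∧ ∀ i ∈ D, (L.filter fun v => f v = i).card = cap i := by
  induction L using Finset.induction_on with
  | empty =>
    intro cap hcap
    refine ⟨id, by simp, fun i hi => ?_⟩
    have := (sum_eq_zero_iff.1 (hcap.trans card_empty)) i hi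
    simp [this]
  | insert v L hv ih =>
    intro cap hcap
    rw [card_insert_of_notMem hv] at hcap
    obtain ⟨i₀, hi₀, hpos⟩ : ∃ i ∈ D, 0 < cap i := by
      by_contra h
      push Not at h
      have : ∑ i ∈ D, cap i = 0 := sum_eq_zero fun i hi => by have := h i hi; omega
      omega
    obtain ⟨f, hf1, hf2⟩ := ih (fun i => cap i - if i = i₀ then 1 else 0) (by
      have h1 : ∑ i ∈ D, (cap i - if i = i₀ then 1 else 0) + ∑ i ∈ D, (if i = i₀ then 1 else 0) =
          ∑ i ∈ D, cap i := by
        rw [← sum_add_distrib]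
        refine sum_congr rfl fun i _ => ?_
        split_ifs <;> grind
      rw [sum_ite_eq_card hi₀] at h1
      omega)
    refine ⟨Function.update f v i₀, ?_, ?_⟩
    · intro w hw
      rcases mem_insert.1 hw with rfl | hw
      · simpa using hi₀
      · rw [Function.update_of_ne (fun h : w = v => hv (h ▸ hw))]
        exact hf1 w hw
    · intro i hi
      have hL : (L.filter fun w => Function.update f v i₀ w = i) = L.filter fun w => f w = i := by
        refine filter_congr fun w hw => ?_
        rw [Function.update_of_ne (fun h : w = v => hv (h ▸ hw))]
      have := hf2 i hi
      rw [filter_insert, hL, Function.update_self]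
      by_cases h : i₀ = i
      · rw [if_pos h, card_insert_of_notMem (fun h' => hv (mem_of_mem_filter _ h')), this]
        subst h
        simp only [if_true]
        omega
      · rw [if_neg h, this, if_neg (Ne.symm h)]
        omega

/-- If few vertices need more than one edge to `D`, then the edges that meet `D` can be chosen. -/
theorem IsState.exists_split_of_card_le (hs : IsState d D m H e) {δ : ℕ} (hδ : ∀ i ∈ D, δ ≤ d i)
    (hY : (multi D e).card + min m (D.card - 1) ≤ δ) :
    ∃ F : SimpleGraph V, (∀ a b, F.Adj a b → a ∈ D ∨ b ∈ D) ∧ (∀ i ∈ D, deg F i = d i) ∧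
      ∀ v, v ∉ D → deg F v = e v := by
  obtain ⟨K, hK1, hK2, hK3⟩ := exists_graph_on D m hs.two_le
  have hKle : ∀ i ∈ D, deg K i ≤ D.card - 1 := fun i hi => by
    rw [← card_erase_of_mem hi]
    refine card_le_card fun j hj => ?_
    rw [mem_nbr] at hj
    exact mem_erase.2 ⟨hj.ne', hK1 _ _ hj.symm⟩
  have hS : ∀ v, ∃ S : Finset V, v ∉ D → S ⊆ D ∧ S.card = e v := by
    intro v
    by_cases hv : v ∈ D
    · exact ⟨∅, fun h => absurd hv h⟩
    · obtain ⟨S, h1, h2⟩ := exists_subset_card_eq (hs.le v hv)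
      exact ⟨S, fun _ => ⟨h1, h2⟩⟩
  choose S hS using hS
  set Y := multi D e with hYdef
  have hYD : ∀ v ∈ Y, v ∉ D := fun v hv => (mem_multi.1 hv).1
  -- The subtractions do not truncate: `deg K i` is at most `min m (D.card - 1)` and the last term
  -- at most `Y.card`, which together stay below `δ ≤ d i`.
  set cap : V → ℕ := fun i => d i - deg K i - (Y.filter fun v => i ∈ S v).card with hcap
  have hcapeq : ∀ i ∈ D, cap i + (deg K i + (Y.filter fun v => i ∈ S v).card) = d i := by
    intro i hi
    have h1 := hδ i hi
    have h2 := hK3 i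
    have h3 := hKle i hi
    have h4 : (Y.filter fun v => i ∈ S v).card ≤ Y.card := card_filter_le _ _
    simp only [hcap]
    omega
  have hdouble : ∑ i ∈ D, (Y.filter fun v => i ∈ S v).card = ∑ v ∈ Y, e v := by
    simp only [card_filter]
    rw [sum_comm]
    refine sum_congr rfl fun v hv => ?_
    obtain ⟨h1, h2⟩ := hS v (hYD v hv)
    rw [← card_filter, ← h2]
    congr 1
    ext i
    simp only [mem_filter]
    exact ⟨fun h => h.2, fun h => ⟨h1 h, h⟩⟩
  have hYc : Y ⊆ Dᶜ := fun v hv => by simpa using hYD v hv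
  have hcapsum : ∑ i ∈ D, cap i = (Dᶜ \ Y).card := by
    have h1 : ∑ i ∈ D, cap i + (2 * m + ∑ v ∈ Y, e v) = ∑ i ∈ D, d i := by
      rw [← hdouble, ← hK2, ← sum_add_distrib, ← sum_add_distrib]
      exact sum_congr rfl hcapeq
    have h2 := hs.sum
    have h3 : ∑ v ∈ Dᶜ \ Y, e v = (Dᶜ \ Y).card := by
      rw [card_eq_sum_ones]
      refine sum_congr rfl fun v hv => ?_
      rw [mem_sdiff, mem_compl, mem_multi] at hv
      have := hs.pos v hv.1
      by_contra h
      exact hv.2 ⟨hv.1, by omega⟩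
    have h4 := sum_sdiff (f := e) hYc
    omega
  obtain ⟨f, hf1, hf2⟩ := exists_fiber_card D (Dᶜ \ Y) cap hcapsum
  set T : V → Finset V := fun v => if v ∈ Y then S v else {f v} with hT
  have hTD : ∀ v, v ∉ D → T v ⊆ D ∧ (T v).card = e v := by
    intro v hv
    by_cases hvY : v ∈ Y
    · simpa [hT, hvY] using hS v hv
    · have hvL : v ∈ Dᶜ \ Y := by simp [hv, hvY]
      simp only [hT, hvY, if_false, card_singleton, singleton_subset_iff]
      refine ⟨hf1 v hvL, ?_⟩
      have := hs.pos v hv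
      by_contra h
      exact hvY (mem_multi.2 ⟨hv, by omega⟩)
  let F : SimpleGraph V :=
    { Adj := fun a b => K.Adj a b ∨ (a ∉ D ∧ b ∈ T a) ∨ (b ∉ D ∧ a ∈ T b)
      symm := ⟨fun a b h => by
        rcases h with h | h | h
        · exact Or.inl h.symm
        · exact Or.inr (Or.inr h)
        · exact Or.inr (Or.inl h)⟩
      loopless := ⟨fun a h => by
        rcases h with h | h | h
        · exact K.irrefl h
        · exact h.1 ((hTD a h.1).1 h.2)
        · exact h.1 ((hTD a h.1).1 h.2)⟩ }
  have hF : ∀ a b, F.Adj a b ↔ K.Adj a b ∨ (a ∉ D ∧ b ∈ T a) ∨ (b ∉ D ∧ a ∈ T b) :=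
    fun a b => Iff.rfl
  refine ⟨F, ?_, ?_, ?_⟩
  · intro a b h
    rcases (hF a b).1 h with h | h | h
    · exact Or.inl (hK1 a b h)
    · exact Or.inr ((hTD a h.1).1 h.2)
    · exact Or.inl ((hTD b h.1).1 h.2)
  · intro i hi
    have h1 : nbr F i = nbr K i ∪ Dᶜ.filter fun v => i ∈ T v := by
      ext v
      simp only [mem_nbr, hF, mem_union, mem_filter, mem_compl, hi, not_true, false_and, false_or]
    have h2 : Disjoint (nbr K i) (Dᶜ.filter fun v => i ∈ T v) := by
      rw [disjoint_left]
      intro v hv hv'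
      rw [mem_nbr] at hv
      simp only [mem_filter, mem_compl] at hv'
      exact hv'.1 (hK1 _ _ hv.symm)
    have h3 : (Dᶜ.filter fun v => i ∈ T v) =
        (Y.filter fun v => i ∈ S v) ∪ ((Dᶜ \ Y).filter fun v => f v = i) := by
      ext v
      simp only [mem_filter, mem_compl, mem_union, mem_sdiff, hT]
      by_cases hvY : v ∈ Y
      · have := hYD v hvY
        simp [hvY, this]
      · simp only [hvY, if_false, mem_singleton, false_and, not_false_eq_true, and_true, false_or]
        rw [eq_comm]
    have h4 : Disjoint (Y.filter fun v => i ∈ S v) ((Dᶜ \ Y).filter fun v => f v = i) := by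
      rw [disjoint_left]
      intro v hv hv'
      simp only [mem_filter, mem_sdiff] at hv hv'
      exact hv'.1.2 hv.1
    rw [deg, h1, card_union_of_disjoint h2, h3, card_union_of_disjoint h4, hf2 i hi]
    have := hcapeq i hi
    unfold deg at this
    omega
  · intro v hv
    have h1 : nbr F v = T v := by
      ext i
      rw [mem_nbr, hF]
      constructor
      · rintro (h | h | h)
        · exact absurd (hK1 _ _ h) hv
        · exact h.2
        · exact absurd ((hTD i h.1).1 h.2) hv
      · exact fun h => Or.inr (Or.inl ⟨hv, h⟩)
    rw [deg, h1]
    exact (hTD v hv).2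

/-- For a smallest `D`, and then a smallest `m`, the edges that meet `D` can be chosen. -/
theorem IsState.exists_split (hs : IsState d D m H e)
    (hreal : ∃ G : SimpleGraph V, ∀ v, deg G v = d v) {c : V} (hc : c ∈ D)
    (hmax : ∀ v, v ∉ D → d v ≤ d c) (hmin : ∀ i ∈ D, d c ≤ d i) (hcpos : 1 ≤ d c)
    (hD : ¬ ∃ m' H' e', IsState d (D.erase c) m' H' e')
    (hm : 1 ≤ m → ¬ ∃ H' e', IsState d D (m - 1) H' e') :
    ∃ F : SimpleGraph V, (∀ a b, F.Adj a b → a ∈ D ∨ b ∈ D) ∧ (∀ i ∈ D, deg F i = d i) ∧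
      ∀ v, v ∉ D → deg F v = e v := by
  by_contra hcon
  have hbad : d c < (multi D e).card + min m (D.card - 1) := by
    by_contra h
    exact hcon (hs.exists_split_of_card_le hmin (not_lt.1 h))
  have hDpos : 0 < D.card := card_pos.2 ⟨c, hc⟩
  have hk : 2 ≤ D.card := by
    by_contra h
    have h1 : D.card = 1 := by omega
    have h2 : multi D e = ∅ := by
      rw [eq_empty_iff_forall_notMem]
      intro v hv
      rw [mem_multi] at hv
      have := hs.le v hv.1
      omega
    rw [h2, h1] at hbad
    simp at hbad
  rcases Nat.eq_zero_or_pos m with h0 | hpos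
  · subst h0
    simp only [Nat.zero_min, Nat.add_zero] at hbad
    obtain ⟨x, hx⟩ := card_pos.1 (by omega : 0 < (multi D e).card)
    obtain ⟨u, hu, w, hw, huw, hn⟩ := exists_not_adj (H := H) hx (by
      have h1 := mem_multi.1 hx
      have := hs.deg_add x h1.1
      have := hmax x h1.1
      omega)
    -- `descent` needs `m ≥ 1`, so one edge is first shifted into `D`. This costs at most two
    -- members of `multi` and gains one in the minimum, which the strict inequality `hbad` can
    -- afford.
    have hs' := hs.addEdge huw hn hu hw (by nlinarith [Nat.sub_add_cancel hDpos])
    have hle : d c < (multi D fun v =>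
        e v - (if v = u then 1 else 0) - (if v = w then 1 else 0)).card + min (0 + 1) (D.card - 1) + 1 := by
      have hsub : ((multi D e).erase u).erase w ⊆
          multi D (fun v => e v - (if v = u then 1 else 0) - (if v = w then 1 else 0)) := by
        intro v hv
        simp only [mem_erase] at hv
        have h1 := mem_multi.1 hv.2.2
        exact mem_multi.2 ⟨h1.1, by simpa [hv.1, hv.2.1] using h1.2⟩
      have h1 := card_le_card hsub
      rw [card_erase_of_mem (mem_erase.2 ⟨huw.symm, hw⟩), card_erase_of_mem hu] at h1
      omega
    rcases descent hreal hc hmax hcpos hk _ _ _ _ hs' le_rfl (by omega) rfl with h | h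
    · exact hD h
    -- With `m = 1` the outcome that lowers `m` is excluded by its clause `2 ≤ m`.
    · omega
  · rcases descent hreal hc hmax hcpos hk _ _ _ _ hs hpos (by omega) rfl with h | h
    · exact hD h
    · exact hm hpos h.2.2

/-- A realization dominated by `D` gives a state. -/
theorem exists_isState {G : SimpleGraph V} (hG : ∀ v, deg G v = d v)
    (hdom : ∀ v, v ∉ D → ∃ u ∈ D, G.Adj u v) : ∃ m H e, IsState d D m H e := by
  classical
  have hsplit : ∀ v, ((nbr G v) ∩ D).card + ((nbr G v) ∩ Dᶜ).card = deg G v := by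
    intro v
    rw [deg, ← card_union_of_disjoint, ← inter_union_distrib_left]
    · simp
    · exact (disjoint_compl_right.mono inter_subset_right inter_subset_right)
  let K : SimpleGraph V :=
    { Adj := fun a b => G.Adj a b ∧ a ∈ D ∧ b ∈ D
      symm := ⟨fun a b h => ⟨h.1.symm, h.2.2, h.2.1⟩⟩
      loopless := ⟨fun a h => G.irrefl h.1⟩ }
  let H : SimpleGraph V :=
    { Adj := fun a b => G.Adj a b ∧ a ∉ D ∧ b ∉ D
      symm := ⟨fun a b h => ⟨h.1.symm, h.2.2, h.2.1⟩⟩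
      loopless := ⟨fun a h => G.irrefl h.1⟩ }
  have hKdeg : ∀ i ∈ D, deg K i = ((nbr G i) ∩ D).card := fun i hi => by
    rw [deg]; congr 1; ext j; simp [K, hi]
  have hKdeg0 : ∀ i, i ∉ D → deg K i = 0 := fun i hi => by
    rw [deg, card_eq_zero, eq_empty_iff_forall_notMem]; intro j; simp [K, hi]
  have hHdeg : ∀ v, v ∉ D → deg H v = ((nbr G v) ∩ Dᶜ).card := fun i hi => by
    rw [deg]; congr 1; ext j; simp [H, hi]
  -- Handshake lemma in the graph induced on `D`.
  obtain ⟨m, hm⟩ : ∃ m, ∑ i ∈ D, ((nbr G i) ∩ D).card = 2 * m := by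
    refine ⟨K.edgeFinset.card, ?_⟩
    rw [← K.sum_degrees_eq_twice_card_edges, ← sum_subset (subset_univ D)]
    · refine sum_congr rfl fun i hi => ?_
      rw [← hKdeg i hi, deg, ← SimpleGraph.card_neighborFinset_eq_degree]
      congr 1; ext j; simp
    · intro i _ hi
      rw [← hKdeg0 i hi, deg, ← SimpleGraph.card_neighborFinset_eq_degree]
      congr 1; ext j; simp
  have hcross : ∑ i ∈ D, ((nbr G i) ∩ Dᶜ).card = ∑ v ∈ Dᶜ, ((nbr G v) ∩ D).card := by
    have e1 : ∀ (A : Finset V) (i : V),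
        ((nbr G i) ∩ A).card = ∑ j ∈ A, if G.Adj i j then 1 else 0 := by
      intro A i
      rw [← card_filter]
      congr 1
      ext j; simp [and_comm]
    simp only [e1]
    rw [sum_comm]
    refine sum_congr rfl fun v _ => sum_congr rfl fun i _ => ?_
    simp [G.adj_comm]
  refine ⟨m, H, fun v => ((nbr G v) ∩ D).card, ?_, ?_, ?_, ?_, ?_, ?_⟩
  · exact fun v w h => h.2.1
  · intro v hv
    rw [hHdeg v hv, ← hG v, ← hsplit v, add_comm]
  · intro v hv
    obtain ⟨u, huD, hu⟩ := hdom v hv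
    exact card_pos.2 ⟨u, by simp [huD, hu.symm]⟩
  · exact fun v _ => card_le_card inter_subset_right
  · rw [← hcross, ← hm, ← sum_add_distrib]
    refine sum_congr rfl fun i _ => ?_
    rw [← hG i, ← hsplit i, add_comm]
  · rw [← hm, ← smul_eq_mul]
    refine sum_le_card_nsmul _ _ _ fun i hi => ?_
    rw [← card_erase_of_mem hi]
    refine card_le_card fun j hj => ?_
    simp only [mem_inter, mem_nbr] at hj
    exact mem_erase.2 ⟨hj.1.ne', hj.2⟩

end State

open RAM

/-! ### Structured reasoning about programs -/

/-- A bound for the cost of a program in which no loop runs more than `X` times. -/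
noncomputable def costPoly : Program → Polynomial ℕ
  | .skip => 1
  | .assign _ t => ((t.cost + 1 : ℕ) : Polynomial ℕ)
  | .store _ i t => ((i.cost + t.cost + 1 : ℕ) : Polynomial ℕ)
  | .seq p q => costPoly p + costPoly q
  | .cond t p q => ((t.cost + 1 : ℕ) : Polynomial ℕ) + costPoly p + costPoly q
  | .loop t p => (Polynomial.X + 1) * ((t.cost + 1 : ℕ) : Polynomial ℕ) + Polynomial.X * costPoly p

/-- The variables that a program may assign to. -/
def assigns : Program → ℕ → Bool
  | .skip, _ => false
  | .assign x _, y => x == y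
  | .store _ _ _, _ => false
  | .seq p q, y => assigns p y || assigns q y
  | .cond _ p q, y => assigns p y || assigns q y
  | .loop _ p, y => assigns p y

/-- The arrays that a program may store to. -/
def stores : Program → ℕ → Bool
  | .skip, _ => false
  | .assign _ _, _ => false
  | .store a _ _, b => a == b
  | .seq p q, y => stores p y || stores q y
  | .cond _ p q, y => stores p y || stores q y
  | .loop _ p, y => stores p y

/-- `m'` differs from `m` only in what `p` may write. -/
structure Frame (p : Program) (m m' : Memory) : Prop where
  var : ∀ y, assigns p y = false → m'.var y = m.var y
  arr : ∀ a, stores p a = false → m'.arr a = m.arr a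

theorem Frame.refl (p : Program) (m : Memory) : Frame p m m := ⟨fun _ _ => rfl, fun _ _ => rfl⟩

theorem Frame.trans {p : Program} {m₁ m₂ m₃ : Memory} (h : Frame p m₁ m₂) (h' : Frame p m₂ m₃) :
    Frame p m₁ m₃ :=
  ⟨fun y hy => (h'.var y hy).trans (h.var y hy), fun a ha => (h'.arr a ha).trans (h.arr a ha)⟩

theorem Frame.mono {p q : Program} {m m' : Memory} (h : Frame p m m')
    (hv : ∀ y, assigns q y = false → assigns p y = false)
    (ha : ∀ a, stores q a = false → stores p a = false) : Frame q m m' :=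
  ⟨fun y hy => h.var y (hv y hy), fun a hs => h.arr a (ha a hs)⟩

@[simp] theorem var_setVar (m : Memory) (x v y : ℕ) :
    (m.setVar x v).var y = if y = x then v else m.var y := by
  simp [Memory.setVar, Function.update_apply]

@[simp] theorem arr_setVar (m : Memory) (x v : ℕ) : (m.setVar x v).arr = m.arr := rfl

@[simp] theorem var_setArr (m : Memory) (a i v : ℕ) : (m.setArr a i v).var = m.var := rfl

@[simp] theorem arr_setArr (m : Memory) (a i v b j : ℕ) :
    (m.setArr a i v).arr b j = if b = a ∧ j = i then v else m.arr b j := by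
  simp only [Memory.setArr, Function.update_apply]
  split_ifs <;> simp_all

/-- `assigns` and `stores` are computed from the syntax, so for a concrete program the fact that a
variable or an array is untouched is proved by `rfl`. Specifications need to mention only what
changes. -/
theorem frame_of_runs {p : Program} {m m' : Memory} {c : ℕ} (h : Runs p m m' c) :
    Frame p m m' := by
  induction h with
  | skip m => exact Frame.refl _ _
  | assign m x t =>
    refine ⟨fun y hy => ?_, fun _ _ => rfl⟩
    have : y ≠ x := by rintro rfl; simp [assigns] at hy
    simp [this]
  | store m a i t =>
    refine ⟨fun _ _ => rfl, fun b hb => ?_⟩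
    have : b ≠ a := by rintro rfl; simp [stores] at hb
    simp [Memory.setArr, this]
  | seq _ _ h1 h2 =>
    exact (h1.mono (by simp +contextual [assigns]) (by simp +contextual [stores])).trans
      (h2.mono (by simp +contextual [assigns]) (by simp +contextual [stores]))
  | condTrue _ _ h1 => exact h1.mono (by simp +contextual [assigns]) (by simp +contextual [stores])
  | condFalse _ _ h1 => exact h1.mono (by simp +contextual [assigns]) (by simp +contextual [stores])
  | loopTrue _ _ _ h1 h2 => exact (h1.mono (by simp [assigns]) (by simp [stores])).trans h2
  | loopFalse => exact Frame.refl _ _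

theorem frame_setVar {p : Program} {x : ℕ} (h : assigns p x = true) (m : Memory) (v : ℕ) :
    Frame p m (m.setVar x v) := by
  refine ⟨fun y hy => ?_, fun _ _ => rfl⟩
  have : y ≠ x := by rintro rfl; simp [h] at hy
  simp [this]

/-- Started with memory `m`, the program `p` halts within the cost bound for loops of at most `N`
iterations, and the final memory satisfies `Q`. -/
def Ensures (N : ℕ) (p : Program) (m : Memory) (Q : Memory → Prop) : Prop :=
  ∃ m' c, Runs p m m' c ∧ c ≤ (costPoly p).eval N ∧ Q m'

variable {N : ℕ} {p q : Program} {m : Memory} {Q R : Memory → Prop} {t : Term}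

theorem Ensures.mono (h : Ensures N p m Q) (hQ : ∀ m', Frame p m m' → Q m' → R m') :
    Ensures N p m R := by
  obtain ⟨m', c, h1, h2, h3⟩ := h
  exact ⟨m', c, h1, h2, hQ m' (frame_of_runs h1) h3⟩

theorem ensures_skip (h : Q m) : Ensures N .skip m Q :=
  ⟨m, 1, .skip m, by simp [costPoly], h⟩

theorem ensures_assign {x : ℕ} (h : Q (m.setVar x (t.eval m))) : Ensures N (.assign x t) m Q :=
  ⟨_, _, .assign m x t, by simp [costPoly], h⟩

theorem ensures_store {a : ℕ} {i : Term} (h : Q (m.setArr a (i.eval m) (t.eval m))) :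
    Ensures N (.store a i t) m Q :=
  ⟨_, _, .store m a i t, by simp [costPoly], h⟩

theorem ensures_seq (h : Ensures N p m fun m' => Ensures N q m' Q) :
    Ensures N (.seq p q) m Q := by
  obtain ⟨m₁, b, h1, h2, m₂, c, h3, h4, h5⟩ := h
  exact ⟨m₂, b + c, .seq h1 h3, by simp only [costPoly, Polynomial.eval_add]; omega, h5⟩

theorem ensures_cond (h1 : t.eval m ≠ 0 → Ensures N p m Q) (h2 : t.eval m = 0 → Ensures N q m Q) :
    Ensures N (.cond t p q) m Q := by
  by_cases h : t.eval m = 0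
  · obtain ⟨m', c, h3, h4, h5⟩ := h2 h
    exact ⟨m', _, .condFalse h h3,
      by simp only [costPoly, Polynomial.eval_add, Polynomial.eval_natCast, Nat.cast_id]; omega, h5⟩
  · obtain ⟨m', c, h3, h4, h5⟩ := h1 h
    exact ⟨m', _, .condTrue h h3,
      by simp only [costPoly, Polynomial.eval_add, Polynomial.eval_natCast, Nat.cast_id]; omega, h5⟩

/-- Run `p` for `x = lo, …, hi - 1`. -/
def forLoop (x : ℕ) (lo hi : Term) (p : Program) : Program :=
  .seq (.assign x lo) (.loop (.sub hi (.var x)) (.seq p (.assign x (.add (.var x) (.lit 1)))))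

/-- The rule for loops with an invariant `I`. The body may change neither the counter `x` nor the
value of the bound `hi`; hence there are exactly `b - a ≤ N` rounds, which yields the cost bound. -/
theorem ensures_forLoop {x : ℕ} {lo hi : Term} {a b : ℕ} (I : ℕ → Memory → Prop) (hab : a ≤ b)
    (hN : b - a ≤ N) (hlo : lo.eval m = a)
    (hhi : ∀ m', Frame (forLoop x lo hi p) m m' → hi.eval m' = b)
    (h0 : I a (m.setVar x a))
    (hstep : ∀ i m', a ≤ i → i < b → m'.var x = i → Frame (forLoop x lo hi p) m m' → I i m' →
      Ensures N p m' fun m'' => m''.var x = i ∧ I (i + 1) (m''.setVar x (i + 1)))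
    (hQ : ∀ m', Frame (forLoop x lo hi p) m m' → I b m' → Q m') :
    Ensures N (forLoop x lo hi p) m Q := by
  set L : Program := .loop (.sub hi (.var x)) (.seq p (.assign x (.add (.var x) (.lit 1)))) with hL
  set B : ℕ := (Term.sub hi (.var x)).cost + 1 with hB
  set K : ℕ := (costPoly (.seq p (.assign x (.add (.var x) (.lit 1))))).eval N with hK
  have key : ∀ j i m', b - i = j → a ≤ i → i ≤ b → m'.var x = i →
      Frame (forLoop x lo hi p) m m' → I i m' →
      ∃ m'' c, Runs L m' m'' c ∧ c ≤ (j + 1) * B + j * K ∧ Frame (forLoop x lo hi p) m m'' ∧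
        I b m'' := by
    intro j
    induction j with
    | zero =>
      intro i m' hj hai hib hx hf hI
      have : i = b := by omega
      subst this
      refine ⟨m', B, .loopFalse ?_, by omega, hf, hI⟩
      simp [Term.eval, hhi m' hf, hx]
    | succ j ih =>
      intro i m' hj hai hib hx hf hI
      obtain ⟨m₁, c₁, hr₁, hc₁, hx₁, hI₁⟩ := hstep i m' hai (by omega) hx hf hI
      have hr₂ : Runs (.seq p (.assign x (.add (.var x) (.lit 1)))) m' (m₁.setVar x (i + 1)) _ :=
        .seq hr₁ (by
          have := Runs.assign m₁ x (.add (.var x) (.lit 1))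
          rwa [show (Term.add (.var x) (.lit 1)).eval m₁ = i + 1 by simp [Term.eval, hx₁]] at this)
      have hf' : Frame (forLoop x lo hi p) m (m₁.setVar x (i + 1)) :=
        hf.trans ((frame_of_runs hr₂).mono (by simp +contextual [assigns, forLoop])
          (by simp +contextual [stores, forLoop]))
      obtain ⟨m₂, c₂, hr₃, hc₂, hf₂, hI₂⟩ := ih (i + 1) (m₁.setVar x (i + 1)) (by omega) (by omega)
        (by omega) (by simp) hf' hI₁
      refine ⟨m₂, _, .loopTrue ?_ hr₂ hr₃, ?_, hf₂, hI₂⟩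
      · simp only [Term.eval, hhi m' hf, hx]
        omega
      · have : c₁ + ((Term.add (.var x) (.lit 1)).cost + 1) ≤ K := by
          rw [hK]
          simp only [costPoly, Polynomial.eval_add, Polynomial.eval_natCast, Nat.cast_id]
          omega
        have e1 : (j + 1 + 1) * B = (j + 1) * B + B := by ring
        have e2 : (j + 1) * K = j * K + K := by ring
        omega
  have hf0 : Frame (forLoop x lo hi p) m (m.setVar x a) := by
    have := frame_of_runs (Runs.assign m x lo)
    rw [hlo] at this
    exact this.mono (by simp +contextual [assigns, forLoop]) (by simp [stores])
  obtain ⟨m', c, h1, h2, h3, h4⟩ := key _ a _ rfl le_rfl hab (by simp) hf0 h0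
  have hr := Runs.assign m x lo
  rw [hlo] at hr
  refine ⟨m', _, .seq hr h1, ?_, hQ m' h3 h4⟩
  have e : (costPoly (forLoop x lo hi p)).eval N = lo.cost + 1 + ((N + 1) * B + N * K) := by
    rw [hK, hB]
    simp only [forLoop, costPoly, Polynomial.eval_add, Polynomial.eval_natCast, Nat.cast_id,
      Polynomial.eval_mul, Polynomial.eval_X, Polynomial.eval_one]
  rw [e]
  have e1 : (b - a + 1) * B ≤ (N + 1) * B := Nat.mul_le_mul_right _ (by omega)
  have e2 : (b - a) * K ≤ N * K := Nat.mul_le_mul_right _ hN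
  omega

/-! ### The search for a vertex of largest residual degree -/

/-- Variable `10` receives the largest value of array `2` on the `u` (variable `6`) in `[lo, hi)`
with `g ≠ 0`, and variable `7` receives its position, provided that this value is not zero. -/
def argmax (lo hi g : Term) : Program :=
  .seq (.assign 7 (.lit 0)) (.seq (.assign 10 (.lit 0)) (forLoop 6 lo hi
    (.cond g (.cond (.sub (.get 2 (.var 6)) (.var 10))
      (.seq (.assign 7 (.var 6)) (.assign 10 (.get 2 (.var 6)))) .skip) .skip)))

theorem ensures_argmax {N a b : ℕ} {lo hi g : Term} {m : Memory} (cand : ℕ → Prop) (hab : a ≤ b)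
    (hN : b ≤ N) (hlo : ∀ m', Frame (argmax lo hi g) m m' → lo.eval m' = a)
    (hhi : ∀ m', Frame (argmax lo hi g) m m' → hi.eval m' = b)
    (hg : ∀ m', Frame (argmax lo hi g) m m' → (g.eval m' ≠ 0 ↔ cand (m'.var 6))) :
    Ensures N (argmax lo hi g) m fun m' =>
      (∀ u, a ≤ u → u < b → cand u → m.arr 2 u ≤ m'.var 10) ∧
        (m'.var 10 ≠ 0 → a ≤ m'.var 7 ∧ m'.var 7 < b ∧ cand (m'.var 7) ∧
          m.arr 2 (m'.var 7) = m'.var 10) := by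
  unfold argmax
  refine ensures_seq (ensures_assign (ensures_seq (ensures_assign ?_)))
  have hf0 : Frame (argmax lo hi g) m ((m.setVar 7 0).setVar 10 0) :=
    (frame_setVar rfl m 0).trans (frame_setVar rfl _ 0)
  have hf : ∀ m', Frame _ ((m.setVar 7 0).setVar 10 0) m' → Frame (argmax lo hi g) m m' :=
    fun m' h => hf0.trans (h.mono (p := forLoop 6 lo hi
    (.cond g (.cond (.sub (.get 2 (.var 6)) (.var 10))
      (.seq (.assign 7 (.var 6)) (.assign 10 (.get 2 (.var 6)))) .skip) .skip))
      (by simp +contextual [argmax, assigns]) (by simp +contextual [argmax, stores]))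
  refine ensures_forLoop (fun i m' =>
    (∀ u, a ≤ u → u < i → cand u → m.arr 2 u ≤ m'.var 10) ∧
        (m'.var 10 ≠ 0 → a ≤ m'.var 7 ∧ m'.var 7 < i ∧ cand (m'.var 7) ∧
          m.arr 2 (m'.var 7) = m'.var 10)) hab (by omega) (hlo _ hf0) (fun m' h => hhi m' (hf m' h))
    ?_ ?_ ?_
  · refine ⟨fun u h1 h2 => by omega, fun h => ?_⟩
    simp [Term.eval] at h
  · intro i m' hai hib hx hfr ⟨h1, h2⟩
    have harr : m'.arr 2 = m.arr 2 := (hf m' hfr).arr 2 rfl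
    have hgi := hg m' (hf m' hfr)
    rw [hx] at hgi
    have hlt : ∀ u, u ≤ i → u < i ∨ u = i := fun u h => by omega
    refine ensures_cond (fun hc => ensures_cond (fun hc' => ?_) (fun hc' => ?_)) (fun hc => ?_)
    · refine ensures_seq (ensures_assign (ensures_assign ?_))
      simp only [Term.eval, hx, harr] at hc'
      simp only [Term.eval, var_setVar, arr_setVar, hx, harr]
      norm_num
      refine ⟨fun u hu hui hcu => ?_, fun _ => ⟨hai, hgi.1 hc⟩⟩
      rcases hlt u hui with h | h
      · have := h1 u hu h hcu
        omega
      · rw [h]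
    · apply ensures_skip
      simp only [Term.eval, hx, harr] at hc'
      simp only [var_setVar, hx]
      norm_num
      refine ⟨fun u hu hui hcu => ?_, fun h => ?_⟩
      · rcases hlt u hui with h | h
        · exact h1 u hu h hcu
        · rw [h]; omega
      · obtain ⟨h3, h4, h5⟩ := h2 h
        exact ⟨h3, by omega, h5⟩
    · apply ensures_skip
      simp only [var_setVar, hx]
      norm_num
      refine ⟨fun u hu hui hcu => ?_, fun h => ?_⟩
      · rcases hlt u hui with h | h
        · exact h1 u hu h hcu
        · rw [h] at hcu
          exact absurd hc (hgi.2 hcu)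
      · obtain ⟨h3, h4, h5⟩ := h2 h
        exact ⟨h3, by omega, h5⟩
  · exact fun m' _ h => h

/-! ### Completing a graph greedily -/

section Completion

variable {V : Type*} [Fintype V] [DecidableEq V]

/-- `F` has the degrees `r`, is disjoint from `C`, and uses only pairs in `A`. -/
structure IsCompletion (A : V → V → Prop) (C : SimpleGraph V) (r : V → ℕ) (F : SimpleGraph V) :
    Prop where
  deg_eq : ∀ a, deg F a = r a
  allowed : ∀ a b, F.Adj a b → A a b
  disj : ∀ a b, F.Adj a b → ¬ C.Adj a b

variable {A : V → V → Prop} {C F : SimpleGraph V} {r : V → ℕ}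

/-- The Havel–Hakimi exchange. If `F` contains `vu`, this edge passes from `F` to `C`. Otherwise `v`
has an `F`-neighbour `x` with `r x ≤ r u`, so `u` has an `F`-neighbour `z` that `x` lacks; `vx` and
`uz` are replaced by `vu` and `xz`, and `vu` passes to `C`. The hypotheses `hA` and `hC` ensure that
`xz` is allowed and not already in `C`. -/
theorem IsCompletion.exists_addEdge (hF : IsCompletion A C r F) {v u : V} (hvu : v ≠ u)
    (hCvu : ¬ C.Adj v u) (hsymm : ∀ a b, A a b → A b a)
    (hA : ∀ x z, A v x → A u z → A v u ∧ A x z)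
    (hC : ∀ x z, C.Adj x z → r x ≠ 0 → r z ≠ 0 → A x z → x = v ∨ z = v)
    (hmax : ∀ x, F.Adj v x → r x ≤ r u) (hv : r v ≠ 0) :
    ∃ F', IsCompletion A (addEdge C v u)
      (fun a => r a - (if a = v then 1 else 0) - (if a = u then 1 else 0)) F' := by
  by_cases hadj : F.Adj v u
  · refine ⟨delEdge F v u, fun a => ?_, fun a b h => hF.allowed a b (delEdge_adj.1 h).1,
      fun a b h => ?_⟩
    · have h1 := deg_delEdge hadj a
      have h2 := hF.deg_eq a
      omega
    · rw [delEdge_adj] at h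
      rw [addEdge_adj hvu]
      have := hF.disj a b h.1
      tauto
  · obtain ⟨x, hx⟩ := deg_pos_iff.1 (by rw [hF.deg_eq v]; omega : 0 < deg F v)
    have hxu : x ≠ u := fun h => hadj (h ▸ hx)
    obtain ⟨z, hz1, hz2, hz3⟩ := exists_adj_not_adj (G := F) (u := u) (x := x) (v := v)
      (by rw [hF.deg_eq, hF.deg_eq]; exact hmax x hx) hx.symm (fun h => hadj h.symm) hvu
    have hzv : z ≠ v := fun h => hadj (h ▸ hz1.symm)
    obtain ⟨-, hA2⟩ := hA x z (hF.allowed _ _ hx) (hF.allowed _ _ hz1)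
    have hxz : ¬ C.Adj x z := by
      intro h
      rcases hC x z h (by rw [← hF.deg_eq]; exact (deg_pos hx.symm).ne')
        (by rw [← hF.deg_eq]; exact (deg_pos hz1.symm).ne') hA2 with h | h
      · exact hx.ne h.symm
      · exact hzv h
    have h1 : (delEdge F v x).Adj u z := delEdge_adj.2 ⟨hz1, by rintro (h | h) <;> grind⟩
    have h2 : ¬ (delEdge (delEdge F v x) u z).Adj x z := by
      rw [delEdge_adj, delEdge_adj]; tauto
    refine ⟨addEdge (delEdge (delEdge F v x) u z) x z, fun a => ?_, fun a b h => ?_,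
      fun a b h => ?_⟩
    · have e1 := deg_addEdge hz3.symm h2 a
      have e2 := deg_delEdge h1 a
      have e3 := deg_delEdge hx a
      have e4 := hF.deg_eq a
      omega
    · rw [addEdge_adj hz3.symm, delEdge_adj, delEdge_adj] at h
      rcases h with h | ⟨rfl, rfl⟩ | ⟨rfl, rfl⟩
      · exact hF.allowed a b h.1.1
      · exact hA2
      · exact hsymm _ _ hA2
    · rw [addEdge_adj hz3.symm, delEdge_adj, delEdge_adj] at h
      rw [addEdge_adj hvu]
      have h3 : ∀ a b, F.Adj a b → ¬ ((a = v ∧ b = u) ∨ (a = u ∧ b = v)) := by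
        rintro a b hab (⟨rfl, rfl⟩ | ⟨rfl, rfl⟩)
        · exact hadj hab
        · exact hadj hab.symm
      rcases h with h | ⟨rfl, rfl⟩ | ⟨rfl, rfl⟩
      · have := hF.disj a b h.1.1
        have := h3 a b h.1.1
        tauto
      · have := hx.ne
        tauto
      · have := hx.ne
        rw [C.adj_comm]
        tauto

end Completion

section Engine

variable {n : ℕ}

theorem outputsGraph_iff {m : Memory} {G : SimpleGraph (Fin n)} :
    OutputsGraph m G ↔ ∀ i j : Fin n, (G.Adj i j → m.arr 1 (i.val * n + j.val) = 1) ∧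
      (¬ G.Adj i j → m.arr 1 (i.val * n + j.val) = 0) := by
  unfold OutputsGraph
  refine forall_congr' fun i => forall_congr' fun j => ?_
  by_cases h : G.Adj i j <;> simp [h]

theorem cell_eq_iff (i j a b : Fin n) :
    i.val * n + j.val = a.val * n + b.val ↔ i = a ∧ j = b := by
  constructor
  · intro h
    have hn : 0 < n := i.pos
    have h1 : (i.val * n + j.val) / n = (a.val * n + b.val) / n := by rw [h]
    have h2 : (i.val * n + j.val) % n = (a.val * n + b.val) % n := by rw [h]
    rw [mul_comm i.val, mul_comm a.val, Nat.mul_add_div hn, Nat.mul_add_div hn,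
      Nat.div_eq_of_lt j.2, Nat.div_eq_of_lt b.2] at h1
    rw [mul_comm i.val, mul_comm a.val, Nat.mul_add_mod, Nat.mul_add_mod,
      Nat.mod_eq_of_lt j.2, Nat.mod_eq_of_lt b.2] at h2
    exact ⟨Fin.ext (by simpa using h1), Fin.ext h2⟩
  · rintro ⟨rfl, rfl⟩
    rfl

/-- Join the vertex in variable `5` to the admissible vertex of largest residual degree. -/
def linkStep (chi : Term) : Program :=
  -- With truncated subtraction the guard is nonzero exactly if `uv` is not yet an edge and `u ≠ v`.
  -- The latter is read off from the sum of `u - v` and `v - u`, and array `4` supplies the row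
  -- offsets of the matrix.
  .seq (argmax (.lit 0) chi (.sub (.lit 1) (.add (.get 1 (.add (.get 4 (.var 5)) (.var 6)))
    (.sub (.lit 1) (.add (.sub (.var 6) (.var 5)) (.sub (.var 5) (.var 6)))))))
  (.cond (.var 10) (.cond (.get 2 (.var 5))
    (.seq (.store 1 (.add (.get 4 (.var 5)) (.var 7)) (.lit 1))
    (.seq (.store 1 (.add (.get 4 (.var 7)) (.var 5)) (.lit 1))
    (.seq (.store 2 (.var 5) (.sub (.get 2 (.var 5)) (.lit 1)))
      (.store 2 (.var 7) (.sub (.get 2 (.var 7)) (.lit 1)))))) .skip) .skip)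

/-- Each vertex `v` in `[lo, hi)` in turn is joined to up to `n` vertices below `chi`. -/
def engine (lo hi chi : Term) : Program :=
  forLoop 5 lo hi (forLoop 4 (.lit 0) (.var 0) (linkStep chi))

theorem ensures_linkStep {N c : ℕ} {chi : Term} {m : Memory} {C : SimpleGraph (Fin n)}
    (hN : n ≤ N) (hc : c ≤ n) {v : Fin n} (hv : m.var 5 = v)
    (hchi : ∀ m', Frame (linkStep chi) m m' → chi.eval m' = c)
    (hrow : ∀ i, i < n → m.arr 4 i = i * n) (hC : OutputsGraph m C) :
    Ensures N (linkStep chi) m fun m' =>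
      (OutputsGraph m' C ∧ m'.arr 2 = m.arr 2 ∧
        (m.arr 2 v = 0 ∨ ∀ u : Fin n, u.val < c → ¬ C.Adj v u → u ≠ v → m.arr 2 u = 0)) ∨
      ∃ u : Fin n, u.val < c ∧ v ≠ u ∧ ¬ C.Adj v u ∧ m.arr 2 v ≠ 0 ∧ m.arr 2 u ≠ 0 ∧
        (∀ x : Fin n, x.val < c → ¬ C.Adj v x → x ≠ v → m.arr 2 x ≤ m.arr 2 u) ∧
        OutputsGraph m' (addEdge C v u) ∧
        ∀ a : Fin n, m'.arr 2 a =
          m.arr 2 a - (if a = v then 1 else 0) - (if a = u then 1 else 0) := by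
  rw [outputsGraph_iff] at hC
  have hcand : ∀ u : Fin n, (m.arr 1 (v.val * n + u.val) = 0 ∧ u.val ≠ v.val) ↔
      (¬ C.Adj v u ∧ u ≠ v) := by
    intro u
    have h1 := hC v u
    by_cases h : C.Adj v u
    · simp [h, h1.1 h]
    · simp [h, h1.2 h, Fin.ext_iff]
  refine ensures_seq ((ensures_argmax (a := 0) (b := c)
    (fun u => m.arr 1 (v.val * n + u) = 0 ∧ u ≠ v.val) (Nat.zero_le c) (by omega) (fun _ _ => rfl)
    (fun m' h => hchi m' (h.mono (by simp +contextual [linkStep, assigns])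
      (by simp +contextual [linkStep, stores]))) ?_).mono ?_)
  · intro m' hf
    simp only [Term.eval, hf.var 5 rfl, hf.arr 1 rfl, hf.arr 4 rfl, hv, hrow _ v.2]
    omega
  · intro m' hf ⟨h1, h2⟩
    have harr : ∀ a, m'.arr a = m.arr a := fun a => hf.arr a rfl
    have hv' : m'.var 5 = v := (hf.var 5 rfl).trans hv
    refine ensures_cond (fun hc1 => ensures_cond (fun hc2 => ?_) (fun hc2 => ?_)) (fun hc1 => ?_)
    · simp only [Term.eval] at hc1 hc2
      rw [hv', harr] at hc2
      obtain ⟨-, h3, h4, h5⟩ := h2 hc1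
      obtain ⟨u, hu⟩ : ∃ u : Fin n, u.val = m'.var 7 := ⟨⟨m'.var 7, by omega⟩, rfl⟩
      rw [← hu] at h3 h4 h5
      obtain ⟨h6, h7⟩ := (hcand u).1 h4
      have hu' : v.val ≠ u.val := fun h => h7 (Fin.ext h.symm)
      refine ensures_seq (ensures_store (ensures_seq (ensures_store (ensures_seq (ensures_store
        (ensures_store (Or.inr ⟨u, h3, h7.symm, h6, hc2, by omega, fun x hx hx1 hx2 => ?_, ?_, ?_⟩)))))))
      · rw [h5]
        exact h1 x (Nat.zero_le _) hx ((hcand x).2 ⟨hx1, hx2⟩)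
      · rw [outputsGraph_iff]
        intro i j
        have hij := hC i j
        simp only [Term.eval, arr_setArr, var_setArr, hv', harr, ← hu, hrow _ v.2, hrow _ u.2,
          addEdge_adj h7.symm]
        norm_num
        simp only [cell_eq_iff]
        constructor
        · rintro (h | h | h)
          · simp [hij.1 h]
          · simp [h]
          · simp [h]
        · intro h h' h''
          have := hij.2 h
          grind
      · intro a
        simp only [Term.eval, arr_setArr, var_setArr, hv', harr, ← hu, Fin.val_inj]
        norm_num
        grind
    · refine ensures_skip (Or.inl ⟨outputsGraph_iff.2 (by simpa only [harr] using hC), harr 2,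
        Or.inl ?_⟩)
      simpa [Term.eval, hv', harr] using hc2
    · refine ensures_skip (Or.inl ⟨outputsGraph_iff.2 (by simpa only [harr] using hC), harr 2,
        Or.inr fun u hu hu1 hu2 => ?_⟩)
      have := h1 u (Nat.zero_le _) hu ((hcand u).2 ⟨hu1, hu2⟩)
      simp only [Term.eval] at hc1
      omega

/-- `C` arises from `C₀` by new edges between `[a, w)` and `[0, c)`, and the residual degrees `r`
account for them. -/
structure Extends (C₀ : SimpleGraph (Fin n)) (r₀ : ℕ → ℕ) (a c w : ℕ) (C : SimpleGraph (Fin n))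
    (r : ℕ → ℕ) : Prop where
  le : C₀ ≤ C
  deg_add : ∀ i : Fin n, deg C i + r i = deg C₀ i + r₀ i
  adj : ∀ x z, C.Adj x z → C₀.Adj x z ∨ (a ≤ x.val ∧ x.val < w ∧ z.val < c) ∨
    (a ≤ z.val ∧ z.val < w ∧ x.val < c)

variable {C₀ C : SimpleGraph (Fin n)} {r₀ r : ℕ → ℕ} {a b c w : ℕ}

theorem Extends.mono (h : Extends C₀ r₀ a c w C r) {w' : ℕ} (hw : w ≤ w') :
    Extends C₀ r₀ a c w' C r :=
  ⟨h.le, h.deg_add, fun x z hxz => by have := h.adj x z hxz; grind⟩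

theorem Extends.addEdge (h : Extends C₀ r₀ a c w C r) {v u : Fin n} (hav : a ≤ v.val)
    (hvw : v.val < w) (huc : u.val < c) (hvu : v ≠ u) (hCvu : ¬ C.Adj v u) (hv : r v ≠ 0)
    (hu : r u ≠ 0) {r' : ℕ → ℕ}
    (hr' : ∀ x : Fin n, r' x = r x - (if x = v then 1 else 0) - (if x = u then 1 else 0)) :
    Extends C₀ r₀ a c w (addEdge C v u) r' := by
  refine ⟨h.le.trans le_sup_left, fun i => ?_, fun x z hxz => ?_⟩
  · rw [deg_addEdge hvu hCvu, hr', ← h.deg_add i]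
    by_cases h1 : i = v
    · subst h1
      simp [hvu]; omega
    · by_cases h2 : i = u
      · subst h2
        simp [h1]; omega
      · simp [h1, h2]
  · rw [addEdge_adj hvu] at hxz
    rcases hxz with hxz | ⟨rfl, rfl⟩ | ⟨rfl, rfl⟩
    · exact h.adj x z hxz
    · exact Or.inr (Or.inl ⟨hav, hvw, huc⟩)
    · exact Or.inr (Or.inr ⟨hav, hvw, huc⟩)

/-- Degrees are accounted for in any case; only if a completion exists must the residual degrees in
`[a, b)` be used up. The set `A` of allowed pairs describes the edges of the completion, and by
`hAc` and `hA` it is compatible with linking `[a, b)` to `[0, c)`. -/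
theorem ensures_engine {N : ℕ} (hN : n ≤ N) {lo hi chi : Term} (hab : a ≤ b) (hb : b ≤ n)
    (hc : c ≤ n) {m : Memory} (hn : m.var 0 = n) (hlo : lo.eval m = a)
    (hhi : ∀ m', Frame (engine lo hi chi) m m' → hi.eval m' = b)
    (hchi : ∀ m', Frame (engine lo hi chi) m m' → chi.eval m' = c)
    (hrow : ∀ i, i < n → m.arr 4 i = i * n) (hC₀ : OutputsGraph m C₀) {A : Fin n → Fin n → Prop}
    (hsymm : ∀ x z, A x z → A z x)
    (hAc : ∀ v x : Fin n, a ≤ v.val → v.val < b → A v x → x.val < c)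
    (hA : ∀ v u x z : Fin n, a ≤ v.val → v.val < b → u.val < c → A v x → A u z → A v u ∧ A x z)
    (hCA : ∀ x z, C₀.Adj x z → ¬ A x z) :
    Ensures N (engine lo hi chi) m fun m' => ∃ C, OutputsGraph m' C ∧
      Extends C₀ (m.arr 2) a c b C (m'.arr 2) ∧
      ((∃ F, IsCompletion A C₀ (fun i => m.arr 2 i) F) →
        (∃ F, IsCompletion A C (fun i => m'.arr 2 i) F) ∧
          ∀ x : Fin n, a ≤ x.val → x.val < b → m'.arr 2 x = 0) := by
  refine ensures_forLoop (fun i m' => ∃ C, OutputsGraph m' C ∧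
      Extends C₀ (m.arr 2) a c i C (m'.arr 2) ∧
      ((∃ F, IsCompletion A C₀ (fun i => m.arr 2 i) F) →
        (∃ F, IsCompletion A C (fun i => m'.arr 2 i) F) ∧
          ∀ x : Fin n, a ≤ x.val → x.val < i → m'.arr 2 x = 0)) hab (by omega) hlo hhi ?_ ?_
    (fun _ _ h => h)
  · exact ⟨C₀, hC₀, ⟨le_rfl, fun _ => rfl, fun _ _ h => Or.inl h⟩,
      fun h => ⟨h, fun x h1 h2 => by omega⟩⟩
  intro i m₁ hai hib hx hf ⟨C₁, hC₁, hE₁, hH₁⟩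
  obtain ⟨v, hv⟩ : ∃ v : Fin n, v.val = i := ⟨⟨i, by omega⟩, rfl⟩
  subst hv
  have hframe : ∀ m', Frame (forLoop 4 (.lit 0) (.var 0) (linkStep chi)) m₁ m' →
      Frame (engine lo hi chi) m m' := fun m' h =>
    hf.trans (h.mono (by simp +contextual [forLoop, assigns])
      (by simp +contextual [forLoop, stores]))
  refine ensures_forLoop (fun t m' => ∃ C, OutputsGraph m' C ∧
      Extends C₀ (m.arr 2) a c (v + 1) C (m'.arr 2) ∧
      ((∃ F, IsCompletion A C₀ (fun i => m.arr 2 i) F) →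
        (∃ F, IsCompletion A C (fun i => m'.arr 2 i) F) ∧ m'.arr 2 v ≤ n - t ∧
          ∀ x : Fin n, a ≤ x.val → x.val < v → m'.arr 2 x = 0)) (Nat.zero_le n) (by omega) rfl
    (fun m' h => ((hframe m' h).var 0 rfl).trans hn) ?_ ?_ ?_
  · refine ⟨C₁, hC₁, hE₁.mono (Nat.le_succ _), fun h => ?_⟩
    obtain ⟨⟨F, hF⟩, h2⟩ := hH₁ h
    refine ⟨⟨F, hF⟩, ?_, h2⟩
    -- The residual degree of `v` is its degree in a completion, hence below `n`, so `n` rounds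
    -- exhaust it.
    have := deg_lt_card F v
    rw [Fintype.card_fin, hF.deg_eq] at this
    simp only [arr_setVar]
    omega
  · intro t m₂ _ htn ht hf₂ ⟨C₂, hC₂, hE₂, hH₂⟩
    have hfm := hframe m₂ hf₂
    refine (ensures_linkStep (v := v) hN hc ((hf₂.var 5 rfl).trans hx) (fun m' h => hchi m'
      (hfm.trans (h.mono (by simp +contextual [engine, forLoop, assigns])
      (by simp +contextual [engine, forLoop, stores]))))
      (fun i hi => by rw [hfm.arr 4 rfl]; exact hrow i hi) hC₂).mono ?_
    rintro m₃ hf₃ (⟨h1, h2, h3⟩ | ⟨u, hu, hvu, hCvu, hrv, hru, hmax, h1, h2⟩)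
    · refine ⟨?_, C₂, h1, by simpa [h2] using hE₂, fun h => ?_⟩
      · exact (hf₃.var 4 rfl).trans ht
      obtain ⟨⟨F, hF⟩, h4, h5⟩ := hH₂ h
      simp only [arr_setVar, h2]
      refine ⟨⟨F, hF⟩, ?_, h5⟩
      -- A vertex with residual degree left would have a neighbour in the completion, and that
      -- neighbour is an admissible partner with nonzero residual degree.
      have : m₂.arr 2 v = 0 := by
        rcases h3 with h3 | h3
        · exact h3
        · by_contra h0
          obtain ⟨x, hx⟩ := deg_pos_iff.1 (by rw [hF.deg_eq v]; omega : 0 < deg F v)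
          have h6 := deg_pos hx.symm
          rw [hF.deg_eq, h3 x (hAc v x hai hib (hF.allowed _ _ hx)) (hF.disj _ _ hx) hx.ne'] at h6
          omega
      omega
    · refine ⟨?_, addEdge C₂ v u, h1, ?_, fun h => ?_⟩
      · exact (hf₃.var 4 rfl).trans ht
      · exact hE₂.addEdge hai (Nat.lt_succ_self _) hu hvu hCvu hrv hru h2
      · obtain ⟨⟨F, hF⟩, h4, h5⟩ := hH₂ h
        simp only [arr_setVar, h2]
        refine ⟨?_, ?_, ?_⟩
        · refine hF.exists_addEdge hvu hCvu hsymm (fun x z => hA v u x z hai hib hu) ?_ ?_ hrv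
          -- A new edge meets `v` or a vertex treated before `v`, and the latter have no residual
          -- degree left.
          · intro x z hxz hx0 hz0 hxzA
            rcases hE₂.adj x z hxz with h6 | ⟨h6, h7, -⟩ | ⟨h6, h7, -⟩
            · exact absurd hxzA (hCA x z h6)
            · left
              by_contra h8
              exact hx0 (h5 x h6 (lt_of_le_of_ne (Nat.lt_succ_iff.1 h7) fun h => h8 (Fin.ext h)))
            · right
              by_contra h8
              exact hz0 (h5 z h6 (lt_of_le_of_ne (Nat.lt_succ_iff.1 h7) fun h => h8 (Fin.ext h)))
          · intro x hx
            exact hmax x (hAc v x hai hib (hF.allowed _ _ hx)) (hF.disj _ _ hx) hx.ne'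
        · rw [if_pos trivial]
          omega
        · intro x h6 h7
          rw [h5 x h6 h7]
          omega
  · intro m₂ hf₂ ⟨C₂, hC₂, hE₂, hH₂⟩
    refine ⟨(hf₂.var 5 rfl).trans hx, C₂, hC₂, hE₂, fun h => ?_⟩
    obtain ⟨h1, h2, h3⟩ := hH₂ h
    refine ⟨h1, fun x h4 h5 => ?_⟩
    simp only [arr_setVar]
    by_cases h6 : x = v
    · rw [h6]
      omega
    · exact h3 x h4 (lt_of_le_of_ne (Nat.lt_succ_iff.1 h5) fun h => h6 (Fin.ext h))

end Engine

/-! ### Greedy choice of the numbers of edges to `D`. -/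

section Flatten

variable {V : Type*} [Fintype V] [DecidableEq V] {d : V → ℕ} {D : Finset V} {M : ℕ}
  {H : SimpleGraph V} {e f : V → ℕ}

theorem IsState.congr (hs : IsState d D M H e) (h : ∀ v, v ∉ D → e v = f v) :
    IsState d D M H f :=
  ⟨hs.supp, fun v hv => by rw [← h v hv]; exact hs.deg_add v hv,
    fun v hv => by rw [← h v hv]; exact hs.pos v hv,
    fun v hv => by rw [← h v hv]; exact hs.le v hv,
    by rw [← hs.sum]; congr 1; exact sum_congr rfl fun v hv => (h v (mem_compl.1 hv)).symm,
    hs.two_le⟩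

theorem IsState.exists_lt (hs : IsState d D M H e) (hlt : ∑ v ∈ Dᶜ, f v < ∑ v ∈ Dᶜ, e v) :
    ∃ v, v ∉ D ∧ f v < e v ∧ f v < D.card ∧ f v < d v := by
  obtain ⟨v, hv, h⟩ := exists_lt_of_sum_lt hlt
  rw [mem_compl] at hv
  have := hs.le v hv
  have := hs.deg_add v hv
  exact ⟨v, hv, h, by omega, by omega⟩

/-- Raising `f` at the vertex of largest residual degree stays below the numbers of some state. -/
theorem IsState.exists_raise (hs : IsState d D M H e) (hle : ∀ v, v ∉ D → f v ≤ e v)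
    (hpos : ∀ v, v ∉ D → 1 ≤ f v)
    (hlt : ∑ v ∈ Dᶜ, f v < ∑ v ∈ Dᶜ, e v) {w : V} (hw : w ∉ D) (hwD : f w < D.card)
    (hmax : ∀ v, v ∉ D → f v < D.card → d v - f v ≤ d w - f w) :
    ∃ H' e', IsState d D M H' e' ∧ ∀ v, v ∉ D → f v + (if v = w then 1 else 0) ≤ e' v := by
  by_cases hew : f w < e w
  · refine ⟨H, e, hs, fun v hv => ?_⟩
    by_cases h : v = w
    · subst h; simpa using hew
    · simpa [h] using hle v hv
  · have hew' : e w = f w := le_antisymm (not_lt.1 hew) (hle w hw)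
    obtain ⟨v, hv, h1, h2, h3⟩ := hs.exists_lt hlt
    have hvw : v ≠ w := fun h => hew (h ▸ h1)
    -- If the state leaves no slack at `w`, some `v` has slack. As `w` has the largest residual
    -- degree, it has the larger degree in `H`, so an edge of `H` can be moved from `w` to `v`,
    -- which raises `e w` and lowers `e v`.
    have hdeg : deg H v < deg H w := by
      have := hs.deg_add v hv
      have := hs.deg_add w hw
      have := hmax v hv h2
      omega
    obtain ⟨z, hz1, hz2, hz3⟩ := exists_adj_not_adj_of_lt hdeg
    have hv1 := hpos v hv
    refine ⟨_, _, hs.moveEdge hz1 hz2 hz3.symm (mem_multi.2 ⟨hv, by omega⟩) (by omega),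
      fun x hx => ?_⟩
    have := hle x hx
    by_cases h : x = w
    · subst h
      simp [hvw.symm]
      omega
    · by_cases h' : x = v
      · subst h'
        simp [h]
        omega
      · simpa [h, h'] using this

end Flatten

/-! ### Filling arrays, testing for completion, and distributing the excess. -/

section Programs

variable {n : ℕ}

/-- The first `k` vertices. -/
def initial (n k : ℕ) : Finset (Fin n) := univ.filter fun v => v.val < k

@[simp] theorem mem_initial {k : ℕ} {v : Fin n} : v ∈ initial n k ↔ v.val < k := by
  simp [initial]

theorem card_initial {k : ℕ} (hk : k ≤ n) : (initial n k).card = k := by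
  have : initial n k = (univ : Finset (Fin k)).map (Fin.castLEEmb hk) := by
    ext v
    simp only [mem_initial, mem_map, mem_univ, true_and]
    exact ⟨fun h => ⟨⟨v, h⟩, rfl⟩, by rintro ⟨a, rfl⟩; exact a.2⟩
  rw [this, card_map, card_univ, Fintype.card_fin]

/-- Store `t` in the cells `[lo, hi)` of the array `a`. -/
def fill (x : ℕ) (lo hi : Term) (a : ℕ) (t : Term) : Program :=
  forLoop x lo hi (.store a (.var x) t)

theorem ensures_fill {N x a b c : ℕ} {lo hi t : Term} {m : Memory} (f : ℕ → ℕ) (hab : a ≤ b)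
    (hN : b ≤ N) (hlo : lo.eval m = a) (hhi : ∀ m', Frame (fill x lo hi c t) m m' → hi.eval m' = b)
    (ht : ∀ m', Frame (fill x lo hi c t) m m' → m'.var x < b → t.eval m' = f (m'.var x)) :
    Ensures N (fill x lo hi c t) m fun m' =>
      (∀ i, a ≤ i → i < b → m'.arr c i = f i) ∧ ∀ i, i < a ∨ b ≤ i → m'.arr c i = m.arr c i := by
  refine (ensures_forLoop (fun j m' =>
      (∀ i, a ≤ i → i < j → m'.arr c i = f i) ∧ ∀ i, i < a ∨ j ≤ i → m'.arr c i = m.arr c i)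
    hab (by omega) hlo hhi ?_ ?_ ?_)
  · exact ⟨fun i h1 h2 => by omega, fun _ _ => rfl⟩
  · intro j m' haj hjb hx hf ⟨h1, h2⟩
    refine ensures_store ⟨hx, fun i hi1 hi2 => ?_, fun i hi => ?_⟩
    · have := ht m' hf (by omega)
      simp only [arr_setVar, arr_setArr, Term.eval, hx, this]
      by_cases h : i = j
      · simp [h]
      · simpa [h] using h1 i hi1 (by omega)
    · simp only [arr_setVar, arr_setArr, Term.eval, hx]
      rw [if_neg (by omega)]
      exact h2 i (by omega)
  · exact fun _ _ h => h

/-- Set variable `8` if some residual degree is left. -/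
def checkZero : Program :=
  forLoop 6 (.lit 0) (.var 0) (.cond (.get 2 (.var 6)) (.assign 8 (.lit 1)) .skip)

theorem ensures_checkZero {N : ℕ} (hN : n ≤ N) {m : Memory} (hn : m.var 0 = n) :
    Ensures N checkZero m fun m' =>
      m'.var 8 = 0 ↔ m.var 8 = 0 ∧ ∀ i, i < n → m.arr 2 i = 0 := by
  refine ensures_forLoop (fun j m' => m'.var 8 = 0 ↔ m.var 8 = 0 ∧ ∀ i, i < j → m.arr 2 i = 0)
    (Nat.zero_le n) (by omega) rfl (fun m' h => (h.var 0 rfl).trans hn) (by simp) ?_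
    (fun _ _ h => h)
  intro j m' _ hj hx hf h
  have harr : m'.arr 2 = m.arr 2 := hf.arr 2 rfl
  have hlt : ∀ i, i < j + 1 ↔ i < j ∨ i = j := fun i => by omega
  refine ensures_cond (fun hc => ensures_assign ⟨by simpa using hx, ?_⟩)
    (fun hc => ensures_skip ⟨hx, ?_⟩)
  · simp only [Term.eval, hx, harr] at hc
    simp only [Term.eval, var_setVar]
    norm_num
    exact fun _ => ⟨j, le_rfl, hc⟩
  · simp only [Term.eval, hx, harr] at hc
    simp only [var_setVar]
    norm_num
    rw [h]
    refine and_congr_right fun _ => ⟨fun h1 i hi => ?_, fun h1 i hi => h1 i hi.le⟩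
    rcases hi.lt_or_eq with h2 | h2
    · exact h1 i h2
    · rw [h2]; exact hc

/-- Move `E` units from the residual degrees (array `2`) to array `3`, always at a vertex outside
the first `k` of largest residual degree for which array `3` is below `k`. -/
def flatten : Program :=
  forLoop 4 (.lit 0) (.var 2)
    (.seq (argmax (.var 1) (.var 0) (.sub (.var 1) (.get 3 (.var 6))))
      (.cond (.var 10) (.seq (.store 2 (.var 7) (.sub (.get 2 (.var 7)) (.lit 1)))
        (.store 3 (.var 7) (.add (.get 3 (.var 7)) (.lit 1)))) .skip))

/-- The invariant is that array `3` lies below the numbers of some state, renewed by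
`IsState.exists_raise`. After `E` units the sums agree, so array `3` equals those numbers. The value
`M` enters only the analysis. -/
theorem ensures_flatten {N k E M : ℕ} (hN : n ≤ N) (hE : E ≤ N) (hk : k ≤ n) {m : Memory}
    {d : Fin n → ℕ} (hn : m.var 0 = n) (hmk : m.var 1 = k) (hmE : m.var 2 = E)
    (h0 : ∀ i : Fin n, i.val < k → m.arr 2 i = 0)
    (hr : ∀ i : Fin n, k ≤ i.val → m.arr 2 i + m.arr 3 i = d i)
    (he : ∀ i : Fin n, k ≤ i.val → m.arr 3 i = 1) :
    Ensures N flatten m fun m' =>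
      (∀ i : Fin n, i.val < k → m'.arr 2 i = 0) ∧
      (∀ i : Fin n, k ≤ i.val → m'.arr 2 i + m'.arr 3 i = d i ∧ 1 ≤ m'.arr 3 i) ∧
      (∑ i ∈ initial n k, d i = (initial n k)ᶜ.card + E + 2 * M →
        (∃ H e, IsState d (initial n k) M H e) →
        ∃ H, IsState d (initial n k) M H fun i => m'.arr 3 i) := by
  refine ensures_forLoop (fun t m' =>
      (∀ i : Fin n, i.val < k → m'.arr 2 i = 0) ∧
      (∀ i : Fin n, k ≤ i.val → m'.arr 2 i + m'.arr 3 i = d i ∧ 1 ≤ m'.arr 3 i) ∧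
      (∑ i ∈ initial n k, d i = (initial n k)ᶜ.card + E + 2 * M →
        (∃ H e, IsState d (initial n k) M H e) →
        (∃ H e, IsState d (initial n k) M H e ∧ ∀ i, i ∉ initial n k → m'.arr 3 i ≤ e i) ∧
          ∑ i ∈ (initial n k)ᶜ, m'.arr 3 i = (initial n k)ᶜ.card + t))
    (Nat.zero_le E) (by omega) rfl (fun m' h => (h.var 2 rfl).trans hmE) ?_ ?_ ?_
  · refine ⟨h0, fun i hi => ⟨hr i hi, (he i hi).ge⟩, fun h1 ⟨H, e, hs⟩ => ⟨⟨H, e, hs, ?_⟩, ?_⟩⟩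
    · intro i hi
      rw [arr_setVar, he i (by simpa using hi)]
      exact hs.pos i hi
    · rw [card_eq_sum_ones, add_zero]
      refine sum_congr rfl fun i hi => ?_
      rw [arr_setVar, he i (by simpa using hi)]
  · intro t m₁ _ htE ht hf ⟨h1, h2, h3⟩
    have hn₁ : m₁.var 0 = n := (hf.var 0 rfl).trans hn
    have hk₁ : m₁.var 1 = k := (hf.var 1 rfl).trans hmk
    refine ensures_seq ((ensures_argmax (lo := .var 1) (hi := .var 0) (a := k) (b := n)
      (fun u => m₁.arr 3 u < k) hk hN
      (fun m' h => (h.var 1 rfl).trans hk₁) (fun m' h => (h.var 0 rfl).trans hn₁) ?_).mono ?_)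
    · intro m' h
      simp only [Term.eval, h.var 1 rfl, hk₁, h.arr 3 rfl]
      omega
    intro m₂ hf₂ ⟨h4, h5⟩
    have harr : ∀ a, m₂.arr a = m₁.arr a := fun a => hf₂.arr a rfl
    have ht₂ : m₂.var 4 = t := (hf₂.var 4 rfl).trans ht
    have hlt : ∑ i ∈ initial n k, d i = (initial n k)ᶜ.card + E + 2 * M → ∀ H e,
        IsState d (initial n k) M H e →
        ∑ i ∈ (initial n k)ᶜ, m₁.arr 3 i = (initial n k)ᶜ.card + t →
        ∑ i ∈ (initial n k)ᶜ, m₁.arr 3 i < ∑ i ∈ (initial n k)ᶜ, e i := by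
      intro hsum H e hs h
      have := hs.sum
      omega
    refine ensures_cond (fun hc => ?_) (fun hc => ?_)
    · simp only [Term.eval] at hc
      obtain ⟨h6, h7, h8, h9⟩ := h5 hc
      obtain ⟨w, hw⟩ : ∃ w : Fin n, w.val = m₂.var 7 := ⟨⟨m₂.var 7, h7⟩, rfl⟩
      rw [← hw] at h6 h8 h9
      refine ensures_seq (ensures_store (ensures_store ⟨by simpa using ht₂, fun i hi => ?_,
        fun i hi => ?_, fun hsum hst => ?_⟩))
      · simp only [Term.eval, arr_setVar, arr_setArr, var_setArr, harr, ← hw, Fin.val_inj]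
        have : i ≠ w := by rintro rfl; omega
        simpa [this] using h1 i hi
      · simp only [Term.eval, arr_setVar, arr_setArr, var_setArr, harr, ← hw, Fin.val_inj]
        have h10 := h2 i hi
        by_cases h : i = w
        · subst h
          norm_num
          omega
        · simpa [h] using h10
      · obtain ⟨⟨H, e, hs, hle⟩, h10⟩ := h3 hsum hst
        simp only [Term.eval, arr_setVar, arr_setArr, var_setArr, harr, ← hw, Fin.val_inj]
        norm_num
        refine ⟨?_, ?_⟩
        · obtain ⟨H', e', hs', hle'⟩ := hs.exists_raise
            (f := fun i : Fin n => m₁.arr 3 i) hle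
            (fun v hv => (h2 v (by simpa using hv)).2) (hlt hsum H e hs h10) (w := w)
            (by simpa using h6) (by rw [card_initial hk]; exact h8) (fun v hv hvk => by
              rw [card_initial hk] at hvk
              have h11 := h2 v (by simpa using hv)
              have h12 := h2 w h6
              have := h4 v (by simpa using hv) v.2 hvk
              omega)
          refine ⟨H', e', hs', fun i hi => ?_⟩
          have := hle' i (by simpa using hi)
          by_cases h : i = w
          · subst h; simpa using this
          · simpa [h] using this
        · have : ∑ i ∈ (initial n k)ᶜ, (m₁.arr 3 i + (if i = w then 1 else 0)) =
              (initial n k)ᶜ.card + (t + 1) := by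
            rw [sum_add_distrib, h10, sum_ite_eq_card (by simpa using h6)]
            ring
          rw [← this]
          refine sum_congr rfl fun i _ => ?_
          by_cases h : i = w
          · simp [h]
          · simp [h]
    · simp only [Term.eval] at hc
      refine ensures_skip ⟨ht₂, ?_⟩
      simp only [arr_setVar, harr]
      refine ⟨h1, h2, fun hsum hst => ?_⟩
      obtain ⟨⟨H, e, hs, hle⟩, h10⟩ := h3 hsum hst
      obtain ⟨v, hv, h11, h12, h13⟩ := hs.exists_lt (hlt hsum H e hs h10)
      rw [card_initial hk] at h12
      have h14 := h4 v (by simpa using hv) v.2 h12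
      have h15 := h2 v (by simpa using hv)
      omega
  · intro m' _ ⟨h1, h2, h3⟩
    refine ⟨h1, h2, fun hsum hst => ?_⟩
    obtain ⟨⟨H, e, hs, hle⟩, h4⟩ := h3 hsum hst
    refine ⟨H, hs.congr fun v hv => ?_⟩
    have h5 := hs.sum
    refine ((sum_eq_sum_iff_of_le (s := (initial n k)ᶜ) (f := fun i => m'.arr 3 i)
      (fun i hi => hle i (mem_compl.1 hi))).1 (by omega) v (mem_compl.2 hv)).symm

end Programs

/-! ### One attempt for fixed parameters, and the search over all of them. -/

section Attempt

variable {n : ℕ}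

/-- The memory holds the sequence `d` and the multiples of `n`, and `k`, `E` are the current
parameters. -/
structure Ready (d : Fin n → ℕ) (k E : ℕ) (m : Memory) : Prop where
  var_zero : m.var 0 = n
  var_one : m.var 1 = k
  var_two : m.var 2 = E
  input : ∀ i : Fin n, m.arr 0 i = d i
  row : ∀ i, i ≤ n → m.arr 4 i = i * n

variable {d : Fin n → ℕ} {k E M N : ℕ} {m m' : Memory} {p : Program}

theorem Ready.frame (h : Ready d k E m) (hf : Frame p m m') (h0 : assigns p 0 = false)
    (h1 : assigns p 1 = false) (h2 : assigns p 2 = false) (h3 : stores p 0 = false)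
    (h4 : stores p 4 = false) : Ready d k E m' :=
  ⟨(hf.var 0 h0).trans h.var_zero, (hf.var 1 h1).trans h.var_one, (hf.var 2 h2).trans h.var_two,
    fun i => by rw [hf.arr 0 h3]; exact h.input i, fun i hi => by rw [hf.arr 4 h4]; exact h.row i hi⟩

@[simp] theorem deg_bot (i : Fin n) : deg (⊥ : SimpleGraph (Fin n)) i = 0 := by
  simp [deg, nbr]

/-- Start with the empty graph and one edge to the first `k` vertices at each other vertex. -/
def setup : Program :=
  -- Cell `n` of array `4` holds `n * n`, the size of the matrix.
  .seq (.assign 8 (.lit 0)) (.seq (fill 9 (.lit 0) (.get 4 (.var 0)) 1 (.lit 0))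
    (.seq (fill 6 (.lit 0) (.var 1) 2 (.lit 0))
      (.seq (fill 6 (.var 1) (.var 0) 2 (.sub (.get 0 (.var 6)) (.lit 1)))
        (fill 6 (.var 1) (.var 0) 3 (.lit 1)))))

theorem ensures_setup (hk : k ≤ n) (hN : n ≤ N) (hNn : n * n ≤ N) (hd : ∀ i, 0 < d i)
    (hm : Ready d k E m) :
    Ensures N setup m fun m' => m'.var 8 = 0 ∧ OutputsGraph m' (⊥ : SimpleGraph (Fin n)) ∧
      (∀ i : Fin n, i.val < k → m'.arr 2 i = 0) ∧
      (∀ i : Fin n, k ≤ i.val → m'.arr 2 i + m'.arr 3 i = d i) ∧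
      ∀ i : Fin n, k ≤ i.val → m'.arr 3 i = 1 := by
  refine ensures_seq (ensures_assign ?_)
  have hf₀ : Frame setup m (m.setVar 8 ((Term.lit 0).eval m)) := frame_setVar rfl _ _
  have hm₀ := hm.frame hf₀ rfl rfl rfl rfl rfl
  refine ensures_seq ((ensures_fill (fun _ => 0) (Nat.zero_le (n * n)) hNn rfl
    (fun m' h => ?_) (fun _ _ _ => rfl)).mono ?_)
  · have := hm₀.frame h rfl rfl rfl rfl rfl
    simp [Term.eval, this.var_zero, this.row n le_rfl]
  intro m₁ hf₁ ⟨h₁, _⟩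
  have hm₁ := hm₀.frame hf₁ rfl rfl rfl rfl rfl
  refine ensures_seq ((ensures_fill (lo := .lit 0) (hi := .var 1)
    (fun _ => 0) (Nat.zero_le k) (hk.trans hN) rfl
    (fun m' h => (hm₁.frame h rfl rfl rfl rfl rfl).var_one) (fun _ _ _ => rfl)).mono ?_)
  intro m₂ hf₂ ⟨h₂, _⟩
  have hm₂ := hm₁.frame hf₂ rfl rfl rfl rfl rfl
  refine ensures_seq ((ensures_fill (lo := .var 1) (hi := .var 0)
    (fun i => m₂.arr 0 i - 1) hk hN hm₂.var_one
    (fun m' h => (hm₂.frame h rfl rfl rfl rfl rfl).var_zero) (fun m' h _ => ?_)).mono ?_)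
  · simp [Term.eval, h.arr 0 rfl]
  intro m₃ hf₃ ⟨h₃, h₃'⟩
  have hm₃ := hm₂.frame hf₃ rfl rfl rfl rfl rfl
  refine (ensures_fill (lo := .var 1) (hi := .var 0)
    (fun _ => 1) hk hN hm₃.var_one
    (fun m' h => (hm₃.frame h rfl rfl rfl rfl rfl).var_zero) (fun _ _ _ => rfl)).mono ?_
  intro m₄ hf₄ ⟨h₄, _⟩
  refine ⟨?_, ?_, fun i hi => ?_, fun i hi => ?_, fun i hi => h₄ i hi i.2⟩
  · rw [hf₄.var 8 rfl, hf₃.var 8 rfl, hf₂.var 8 rfl, hf₁.var 8 rfl]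
    rfl
  · rw [outputsGraph_iff]
    intro i j
    rw [hf₄.arr 1 rfl, hf₃.arr 1 rfl, hf₂.arr 1 rfl]
    have : i.val * n + j.val < n * n := by
      have h1 := j.2
      have h2 : (i.val + 1) * n ≤ n * n := Nat.mul_le_mul_right _ i.2
      rw [add_mul, one_mul] at h2
      omega
    simp [h₁ _ (Nat.zero_le _) this]
  · rw [hf₄.arr 2 rfl, h₃' i (Or.inl hi)]
    exact h₂ i (Nat.zero_le _) hi
  · rw [hf₄.arr 2 rfl, h₃ i hi i.2, h₄ i hi i.2, hm₂.input]
    have := hd i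
    omega

/-- Choose the numbers of edges to the first `k` vertices, and realize what is left by a graph on
the other vertices. -/
def outerPart : Program :=
  .seq flatten (.seq (engine (.lit 0) (.var 0) (.var 0)) checkZero)

/-- All pairs may be allowed in the engine, because the first `k` vertices have residual degree zero
and receive no edge. The graph of the state that `flatten` reaches is the completion required. -/
theorem ensures_outerPart (hk : k ≤ n) (hN : n ≤ N) (hE : E ≤ N) (hm : Ready d k E m)
    (h8 : m.var 8 = 0) (hG : OutputsGraph m (⊥ : SimpleGraph (Fin n)))
    (h0 : ∀ i : Fin n, i.val < k → m.arr 2 i = 0)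
    (hr : ∀ i : Fin n, k ≤ i.val → m.arr 2 i + m.arr 3 i = d i)
    (he : ∀ i : Fin n, k ≤ i.val → m.arr 3 i = 1) :
    Ensures N outerPart m fun m' => ∃ C : SimpleGraph (Fin n), OutputsGraph m' C ∧
      (∀ i : Fin n, i.val < k → deg C i = 0) ∧ (∀ i : Fin n, k ≤ i.val → 1 ≤ m'.arr 3 i) ∧
      (m'.var 8 = 0 → ∀ i : Fin n, k ≤ i.val → deg C i + m'.arr 3 i = d i) ∧
      (∑ i ∈ initial n k, d i = (initial n k)ᶜ.card + E + 2 * M →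
        (∃ H e, IsState d (initial n k) M H e) →
        m'.var 8 = 0 ∧ ∃ H, IsState d (initial n k) M H fun i => m'.arr 3 i) := by
  refine ensures_seq ((ensures_flatten (M := M) hN hE hk hm.var_zero hm.var_one hm.var_two h0 hr
    he).mono ?_)
  intro m₁ hf₁ ⟨h₁, h₁', h₁''⟩
  have hm₁ := hm.frame hf₁ rfl rfl rfl rfl rfl
  have hG₁ : OutputsGraph m₁ (⊥ : SimpleGraph (Fin n)) := by
    intro i j
    rw [hf₁.arr 1 rfl]
    exact hG i j
  refine ensures_seq ((ensures_engine (lo := .lit 0) (hi := .var 0) (chi := .var 0)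
    (a := 0) (b := n) (c := n)
    (A := fun _ _ => True) hN
    (Nat.zero_le n) le_rfl le_rfl hm₁.var_zero rfl
    (fun m' h => (hm₁.frame h rfl rfl rfl rfl rfl).var_zero)
    (fun m' h => (hm₁.frame h rfl rfl rfl rfl rfl).var_zero) (fun i hi => hm₁.row i hi.le) hG₁
    (fun _ _ _ => trivial) (fun _ x _ _ _ => x.2) (fun _ _ _ _ _ _ _ _ _ => ⟨trivial, trivial⟩)
    (fun _ _ h => absurd h (by simp))).mono ?_)
  intro m₂ hf₂ ⟨C, hC, hE₂, hc₂⟩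
  have hm₂ := hm₁.frame hf₂ rfl rfl rfl rfl rfl
  refine (ensures_checkZero hN hm₂.var_zero).mono ?_
  intro m₃ hf₃ h₃
  have h8₂ : m₂.var 8 = 0 := by rw [hf₂.var 8 rfl, hf₁.var 8 rfl, h8]
  have hdeg := hE₂.deg_add
  simp only [deg_bot, zero_add] at hdeg
  have e3 : m₃.arr 3 = m₁.arr 3 := by rw [hf₃.arr 3 rfl, hf₂.arr 3 rfl]
  refine ⟨C, fun i j => by rw [hf₃.arr 1 rfl]; exact hC i j, fun i hi => ?_, fun i hi => ?_,
    fun h i hi => ?_, fun hsum hst => ?_⟩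
  · have := hdeg i
    rw [h₁ i hi] at this
    omega
  · rw [e3]
    exact (h₁' i hi).2
  · have h4 := (h₃.1 h).2 i i.2
    have h5 := hdeg i
    have h6 := h₁' i hi
    rw [e3]
    omega
  · obtain ⟨H, hH⟩ := h₁'' hsum hst
    refine ⟨h₃.2 ⟨h8₂, fun i hi => ?_⟩, H, by simpa only [e3] using hH⟩
    refine (hc₂ ⟨H, fun i => ?_, fun _ _ _ => trivial, fun _ _ _ => by simp⟩).2 ⟨i, hi⟩
      (Nat.zero_le _) hi
    by_cases hik : i.val < k
    · rw [h₁ i hik]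
      by_contra h
      obtain ⟨x, hx⟩ := deg_pos_iff.1 (Nat.pos_of_ne_zero h)
      exact hH.supp _ _ hx (by simpa using hik)
    · have h5 := hH.deg_add i (by simpa using hik)
      have h6 := h₁' i (not_lt.1 hik)
      omega

/-- Add the edges that meet the first `k` vertices. -/
def innerPart : Program :=
  .seq (fill 6 (.lit 0) (.var 1) 2 (.get 0 (.var 6)))
    (.seq (fill 6 (.var 1) (.var 0) 2 (.get 3 (.var 6)))
      (.seq (engine (.var 1) (.var 0) (.var 1))
        (.seq (engine (.lit 0) (.var 1) (.var 1)) checkZero)))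

/-- The outer vertices are linked to the first `k` before those are linked among themselves, so that
both runs are Havel–Hakimi completions. In the first run pairs inside the first `k` are allowed, but
only for the completion. -/
theorem ensures_innerPart (hk : k ≤ n) (hN : n ≤ N) (hm : Ready d k E m)
    {C : SimpleGraph (Fin n)} (hG : OutputsGraph m C)
    (h0 : ∀ i : Fin n, i.val < k → deg C i = 0) :
    Ensures N innerPart m fun m' => ∃ G : SimpleGraph (Fin n), OutputsGraph m' G ∧
      (m'.var 8 = 0 → m.var 8 = 0 ∧ (∀ i : Fin n, i.val < k → deg G i = d i) ∧
        ∀ i : Fin n, k ≤ i.val → deg G i = deg C i + m.arr 3 i) ∧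
      (∀ x z, G.Adj x z → k ≤ x.val → k ≤ z.val → C.Adj x z) ∧
      (m.var 8 = 0 → (∃ F : SimpleGraph (Fin n),
        (∀ x z, F.Adj x z → x ∈ initial n k ∨ z ∈ initial n k) ∧
        (∀ i ∈ initial n k, deg F i = d i) ∧ ∀ i, i ∉ initial n k → deg F i = m.arr 3 i) →
        m'.var 8 = 0) := by
  have hCout : ∀ x z, C.Adj x z → k ≤ x.val := fun x z h => by
    by_contra h'
    have := deg_pos h
    rw [h0 x (not_le.1 h')] at this
    omega
  refine ensures_seq ((ensures_fill (lo := .lit 0) (hi := .var 1)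
    (fun i => m.arr 0 i) (Nat.zero_le k) (hk.trans hN) rfl
    (fun m' h => (hm.frame h rfl rfl rfl rfl rfl).var_one) (fun m' h _ => ?_)).mono ?_)
  · simp [Term.eval, h.arr 0 rfl]
  intro m₁ hf₁ ⟨h₁, _⟩
  have hm₁ := hm.frame hf₁ rfl rfl rfl rfl rfl
  refine ensures_seq ((ensures_fill (lo := .var 1) (hi := .var 0)
    (fun i => m₁.arr 3 i) hk hN hm₁.var_one
    (fun m' h => (hm₁.frame h rfl rfl rfl rfl rfl).var_zero) (fun m' h _ => ?_)).mono ?_)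
  · simp [Term.eval, h.arr 3 rfl]
  intro m₂ hf₂ ⟨h₂, h₂'⟩
  have hm₂ := hm₁.frame hf₂ rfl rfl rfl rfl rfl
  have hG₂ : OutputsGraph m₂ C := fun i j => by rw [hf₂.arr 1 rfl, hf₁.arr 1 rfl]; exact hG i j
  have hlow : ∀ i : Fin n, i.val < k → m₂.arr 2 i = d i := fun i hi => by
    rw [h₂' i (Or.inl hi), h₁ i (Nat.zero_le _) hi, hm.input]
  have hhigh : ∀ i : Fin n, k ≤ i.val → m₂.arr 2 i = m.arr 3 i := fun i hi => by
    rw [h₂ i hi i.2, hf₁.arr 3 rfl]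
  refine ensures_seq ((ensures_engine (lo := .var 1) (hi := .var 0) (chi := .var 1)
    (a := k) (b := n) (c := k)
    (A := fun x z => x.val < k ∨ z.val < k) hN
    hk le_rfl hk hm₂.var_zero hm₂.var_one
    (fun m' h => (hm₂.frame h rfl rfl rfl rfl rfl).var_zero)
    (fun m' h => (hm₂.frame h rfl rfl rfl rfl rfl).var_one) (fun i hi => hm₂.row i hi.le) hG₂
    (fun _ _ => Or.symm) (fun v x _ _ _ => by omega) (fun v u x z _ _ _ _ _ => by omega)
    (fun x z h => by
      have := hCout x z h
      have := hCout z x h.symm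
      omega)).mono ?_)
  intro m₃ hf₃ ⟨C₃, hC₃, hE₃, hc₃⟩
  have hm₃ := hm₂.frame hf₃ rfl rfl rfl rfl rfl
  have hadj₃ : ∀ x z, C₃.Adj x z → k ≤ x.val ∨ k ≤ z.val := fun x z h => by
    rcases hE₃.adj x z h with h | h | h
    · exact Or.inl (hCout x z h)
    · exact Or.inl h.1
    · exact Or.inr h.1
  refine ensures_seq ((ensures_engine (lo := .lit 0) (hi := .var 1) (chi := .var 1)
    (a := 0) (b := k) (c := k)
    (A := fun x z => x.val < k ∧ z.val < k) hN (Nat.zero_le k) hk hk hm₃.var_zero rfl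
    (fun m' h => (hm₃.frame h rfl rfl rfl rfl rfl).var_one)
    (fun m' h => (hm₃.frame h rfl rfl rfl rfl rfl).var_one) (fun i hi => hm₃.row i hi.le) hC₃
    (fun _ _ => And.symm) (fun v x _ _ h => h.2)
    (fun v u x z _ _ _ h h' => ⟨⟨h.1, h'.1⟩, h.2, h'.2⟩)
    (fun x z h => by
      have := hadj₃ x z h
      omega)).mono ?_)
  intro m₄ hf₄ ⟨C₄, hC₄, hE₄, hc₄⟩
  have hm₄ := hm₃.frame hf₄ rfl rfl rfl rfl rfl
  refine (ensures_checkZero hN hm₄.var_zero).mono ?_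
  intro m₅ hf₅ h₅
  have e8 : m₄.var 8 = m.var 8 := by
    rw [hf₄.var 8 rfl, hf₃.var 8 rfl, hf₂.var 8 rfl, hf₁.var 8 rfl]
  rw [e8] at h₅
  have hdeg : ∀ i : Fin n, deg C₄ i + m₄.arr 2 i = deg C i + m₂.arr 2 i := fun i => by
    rw [hE₄.deg_add i, hE₃.deg_add i]
  refine ⟨C₄, fun i j => by rw [hf₅.arr 1 rfl]; exact hC₄ i j, fun h => ?_, fun x z h hx hz => ?_,
    fun h ⟨F, hF, hF1, hF2⟩ => ?_⟩
  · obtain ⟨h1, h2⟩ := h₅.1 h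
    refine ⟨h1, fun i hi => ?_, fun i hi => ?_⟩
    · have := hdeg i
      rw [h2 i i.2, h0 i hi, hlow i hi] at this
      omega
    · have := hdeg i
      rw [h2 i i.2, hhigh i hi] at this
      omega
  · rcases hE₄.adj x z h with h | h | h
    · rcases hE₃.adj x z h with h | h | h
      · exact h
      · omega
      · omega
    · omega
    · omega
  · refine h₅.2 ⟨h, ?_⟩
    have hcF : IsCompletion (fun x z : Fin n => x.val < k ∨ z.val < k) C
        (fun i => m₂.arr 2 i) F := by
      refine ⟨fun i => ?_, fun x z hxz => by simpa using hF x z hxz, fun x z hxz hC => ?_⟩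
      · by_cases hi : i.val < k
        · rw [hlow i hi]
          exact hF1 i (by simpa using hi)
        · rw [hhigh i (not_lt.1 hi)]
          exact hF2 i (by simpa using hi)
      · have h1 := hCout x z hC
        have h2 := hCout z x hC.symm
        have h3 := hF x z hxz
        simp only [mem_initial] at h3
        omega
    obtain ⟨⟨F', hF'⟩, hz⟩ := hc₃ ⟨F, hcF⟩
    -- The outer residual degrees have vanished, so what remains of the completion lies inside the
    -- first `k` vertices.
    have hlo : ∀ x z, F'.Adj x z → x.val < k := fun x z hxz => by
      by_contra hx
      have := deg_pos hxz
      rw [hF'.deg_eq, hz x (not_lt.1 hx) x.2] at this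
      omega
    obtain ⟨-, hz'⟩ := hc₄ ⟨F', hF'.deg_eq, fun x z hxz => ⟨hlo x z hxz, hlo z x hxz.symm⟩,
      hF'.disj⟩
    intro i hi
    by_cases hik : i < k
    · exact hz' ⟨i, hi⟩ (Nat.zero_le _) hik
    · have h1 := hE₄.deg_add ⟨i, hi⟩
      have h2 := hz ⟨i, hi⟩ (not_lt.1 hik) hi
      have h3 : deg C₃ ⟨i, hi⟩ ≤ deg C₄ ⟨i, hi⟩ :=
        card_le_card fun x hx => by
          rw [mem_nbr] at hx ⊢
          exact hE₄.le hx
      simp only at h1 h2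
      omega

/-- Try to find a realization dominated by the first `k` vertices, with `E` edges more than
necessary between these and the others. -/
def attempt : Program :=
  .seq setup (.seq outerPart (.seq innerPart (.cond (.var 8) .skip (.assign 3 (.lit 1)))))

/-- The first conjunct is soundness, for arbitrary parameters; the second is completeness, when
states exist and all of them split. -/
theorem ensures_attempt (hk : k ≤ n) (hN : n ≤ N) (hNn : n * n ≤ N) (hE : E ≤ N)
    (hd : ∀ i, 0 < d i) (hm : Ready d k E m) (h3 : m.var 3 = 0) :
    Ensures N attempt m fun m' =>
      (m'.var 3 = 0 ∨ m'.var 3 = 1 ∧ ∃ G : SimpleGraph (Fin n), OutputsGraph m' G ∧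
        (∀ i, deg G i = d i) ∧ IsDominatingSet G (initial n k)) ∧
      (∑ i ∈ initial n k, d i = (initial n k)ᶜ.card + E + 2 * M →
        (∃ H e, IsState d (initial n k) M H e) →
        (∀ H e, IsState d (initial n k) M H e → ∃ F : SimpleGraph (Fin n),
          (∀ x z, F.Adj x z → x ∈ initial n k ∨ z ∈ initial n k) ∧
          (∀ i ∈ initial n k, deg F i = d i) ∧ ∀ i, i ∉ initial n k → deg F i = e i) →
        m'.var 3 = 1) := by
  refine ensures_seq ((ensures_setup hk hN hNn hd hm).mono ?_)
  intro m₁ hf₁ ⟨h8, hG, h0, hr, he⟩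
  have hm₁ := hm.frame hf₁ rfl rfl rfl rfl rfl
  refine ensures_seq ((ensures_outerPart (M := M) hk hN hE hm₁ h8 hG h0 hr he).mono ?_)
  intro m₂ hf₂ ⟨C, hC, hC0, hepos, hdeg, hgood⟩
  have hm₂ := hm₁.frame hf₂ rfl rfl rfl rfl rfl
  refine ensures_seq ((ensures_innerPart hk hN hm₂ hC hC0).mono ?_)
  intro m₃ hf₃ ⟨G, hG₃, hG1, hG2, hG3⟩
  have e3 : m₃.var 3 = 0 := by rw [hf₃.var 3 rfl, hf₂.var 3 rfl, hf₁.var 3 rfl, h3]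
  have hgood' : ∑ i ∈ initial n k, d i = (initial n k)ᶜ.card + E + 2 * M →
        (∃ H e, IsState d (initial n k) M H e) →
        (∀ H e, IsState d (initial n k) M H e → ∃ F : SimpleGraph (Fin n),
          (∀ x z, F.Adj x z → x ∈ initial n k ∨ z ∈ initial n k) ∧
          (∀ i ∈ initial n k, deg F i = d i) ∧ ∀ i, i ∉ initial n k → deg F i = e i) →
        m₃.var 8 = 0 := by
    intro hsum hst hF
    obtain ⟨h1, H, hH⟩ := hgood hsum hst
    exact hG3 h1 (hF _ _ hH)
  refine ensures_cond (fun hc => ensures_skip ⟨Or.inl e3, fun h1 h2 h4 => ?_⟩)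
    (fun hc => ensures_assign ⟨Or.inr ⟨by simp [Term.eval], G, hG₃, fun i => ?_, fun v hv => ?_⟩,
      fun _ _ _ => by simp [Term.eval]⟩)
  · exact absurd (hgood' h1 h2 h4) hc
  · obtain ⟨h1, h2, h4⟩ := hG1 hc
    by_cases hi : i.val < k
    · exact h2 i hi
    · rw [h4 i (not_lt.1 hi), hdeg h1 i (not_lt.1 hi)]
  · obtain ⟨h1, h2, h4⟩ := hG1 hc
    have hv' : k ≤ v.val := by simpa using hv
    by_contra hcon
    push Not at hcon
    -- Without a neighbour among the first `k`, the vertex `v` would have only its edges in `C`, but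
    -- its degree exceeds that by at least one.
    have hsub : nbr G v ⊆ nbr C v := by
      intro x hx
      rw [mem_nbr] at hx ⊢
      refine hG2 v x hx hv' ?_
      by_contra hxk
      exact hcon x (by simpa using hxk) hx.symm
    have := card_le_card hsub
    have h5 := h4 v hv'
    have h6 := hepos v hv'
    unfold deg at h5
    omega

/-- Tabulate the multiples of `n`, then try all values of the parameters. -/
def program : Program :=
  .seq (forLoop 6 (.lit 0) (.var 0)
    -- Multiplication is not available, so each multiple is the previous one plus `n`; cell `0` is
    -- zero from the start.
    (.store 4 (.add (.var 6) (.lit 1)) (.add (.get 4 (.var 6)) (.var 0))))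
    (forLoop 1 (.lit 0) (.add (.var 0) (.lit 1))
      (forLoop 2 (.lit 0) (.add (.get 4 (.var 0)) (.lit 1)) (.cond (.var 3) .skip attempt)))

theorem ensures_program (hN : n * n + n + 1 ≤ N) (hd : ∀ i, 0 < d i) (hk : k ≤ n)
    (hE : E ≤ n * n) (hsum : ∑ i ∈ initial n k, d i = (initial n k)ᶜ.card + E + 2 * M)
    (hst : ∃ H e, IsState d (initial n k) M H e)
    (hsplit : ∀ H e, IsState d (initial n k) M H e → ∃ F : SimpleGraph (Fin n),
      (∀ x z, F.Adj x z → x ∈ initial n k ∨ z ∈ initial n k) ∧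
      (∀ i ∈ initial n k, deg F i = d i) ∧ ∀ i, i ∉ initial n k → deg F i = e i) :
    Ensures N program (inputMemory d) fun m' => ∃ G : SimpleGraph (Fin n), OutputsGraph m' G ∧
      (∀ i, deg G i = d i) ∧ ∃ D : Finset (Fin n), D.card ≤ k ∧ IsDominatingSet G D := by
  let Found (m' : Memory) : Prop := ∃ G : SimpleGraph (Fin n), OutputsGraph m' G ∧
      (∀ i, deg G i = d i) ∧ ∃ D : Finset (Fin n), D.card ≤ k ∧ IsDominatingSet G D
  refine ensures_seq ((ensures_forLoop (lo := .lit 0) (hi := .var 0)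
    (fun i m' => ∀ j, j ≤ i → m'.arr 4 j = j * n)
    (Nat.zero_le n) (by omega) rfl (fun m' h => (h.var 0 rfl).trans (by simp [inputMemory])) ?_ ?_
    (fun _ _ h => h)).mono ?_)
  · intro j hj
    simp [inputMemory, Nat.le_zero.1 hj]
  · intro i m' _ hi hx hf h
    have hn : m'.var 0 = n := (hf.var 0 rfl).trans (by simp [inputMemory])
    refine ensures_store ⟨by simpa using hx, fun j hj => ?_⟩
    simp only [Term.eval, arr_setVar, arr_setArr, hx, hn, h i le_rfl]
    by_cases hji : j = i + 1
    · subst hji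
      simp
      ring
    · simpa [hji] using h j (by omega)
  intro m₁ hf₁ hrow
  have hn₁ : m₁.var 0 = n := (hf₁.var 0 rfl).trans (by simp [inputMemory])
  have h3₁ : m₁.var 3 = 0 := (hf₁.var 3 rfl).trans (by simp [inputMemory])
  have hd₁ : ∀ i : Fin n, m₁.arr 0 i = d i := fun i => by
    rw [hf₁.arr 0 rfl]
    simp [inputMemory]
  refine ensures_forLoop (fun j m' => (m'.var 3 = 0 ∨ m'.var 3 = 1 ∧ Found m') ∧
    (k < j → m'.var 3 = 1)) (Nat.zero_le (n + 1)) (by omega) rfl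
    (fun m' h => by simp [Term.eval, h.var 0 rfl, hn₁]) ?_ ?_ ?_
  · exact ⟨Or.inl (by simpa using h3₁), fun h => by omega⟩
  · intro j m₂ _ hj hj₂ hf₂ ⟨h1, h2⟩
    have hfr : ∀ m', Frame (forLoop 2 (.lit 0) (.add (.get 4 (.var 0)) (.lit 1))
        (.cond (.var 3) .skip attempt)) m₂ m' → Frame (forLoop 1 (.lit 0) (.add (.var 0) (.lit 1))
      (forLoop 2 (.lit 0) (.add (.get 4 (.var 0)) (.lit 1)) (.cond (.var 3) .skip attempt))) m₁ m' :=
      fun m' h => hf₂.trans (h.mono (by simp +contextual [forLoop, assigns])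
        (by simp +contextual [forLoop, stores]))
    refine ensures_forLoop (fun l m' => (m'.var 3 = 0 ∨ m'.var 3 = 1 ∧ Found m') ∧
      (k < j ∨ k = j ∧ E < l → m'.var 3 = 1)) (Nat.zero_le (n * n + 1)) (by omega) rfl
      (fun m' h => ?_) ?_ ?_ ?_
    · have := hfr m' h
      simp [Term.eval, this.var 0 rfl, hn₁, this.arr 4 rfl, hrow n le_rfl]
    · exact ⟨h1, fun h => by
        rw [var_setVar, if_neg (by norm_num)]; exact h2 (by omega)⟩
    · intro l m₃ _ hl hl₃ hf₃ ⟨h4, h5⟩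
      have hf := hfr m₃ hf₃
      have hready : Ready d j l m₃ :=
        ⟨(hf.var 0 rfl).trans hn₁, (hf₃.var 1 rfl).trans hj₂, hl₃,
          fun i => by rw [hf.arr 0 rfl]; exact hd₁ i, fun i hi => by rw [hf.arr 4 rfl]; exact hrow i hi⟩
      refine ensures_cond (fun hc => ensures_skip ⟨hl₃, ?_⟩) (fun hc => ?_)
      · have h6 : m₃.var 3 = 1 ∧ Found m₃ := h4.resolve_left hc
        exact ⟨Or.inr h6, fun _ => h6.1⟩
      · refine (ensures_attempt (M := M) (by omega) (by omega) (by omega) (by omega) hd hready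
          hc).mono ?_
        intro m₄ hf₄ ⟨h6, h7⟩
        -- Once the parameter has passed `k` the flag is set and no attempt is made, so every
        -- success comes from some `j ≤ k`.
        have hkj : ¬ k < j := fun h => by
          have := h5 (Or.inl h)
          simp [Term.eval] at hc
          omega
        refine ⟨(hf₄.var 2 rfl).trans hl₃, ?_, ?_⟩
        · rcases h6 with h6 | ⟨h6, G, hG1, hG2, hG3⟩
          · exact Or.inl h6
          · exact Or.inr ⟨h6, G, hG1, hG2, initial n j, by
              rw [card_initial (by omega)]; omega, hG3⟩
        · rintro (h | ⟨rfl, h⟩)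
          · exact absurd h hkj
          · rw [var_setVar, if_neg (by norm_num)]
            by_cases hEl : E = l
            · subst hEl
              exact h7 hsum hst hsplit
            · have := h5 (Or.inr ⟨rfl, by omega⟩)
              simp [Term.eval] at hc
              omega
    · intro m₃ hf₃ ⟨h4, h5⟩
      refine ⟨(hf₃.var 1 rfl).trans hj₂, h4, fun h => ?_⟩
      rw [var_setVar, if_neg (by norm_num)]
      exact h5 (by omega)
  · intro m' _ ⟨h1, h2⟩
    have := h2 (by omega)
    exact (h1.resolve_left (by omega)).2

end Attempt

/-! ### Minimal parameters and optimality. -/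

section Optimal

variable {n : ℕ} {d : Fin n → ℕ} {k : ℕ}

theorem erase_initial {k : ℕ} (hk : k + 1 ≤ n) :
    (initial n (k + 1)).erase ⟨k, hk⟩ = initial n k := by
  ext v
  simp only [mem_erase, mem_initial, ne_eq, Fin.ext_iff]
  omega

/-- For the least possible `k` and then the least `M`, every state has a matching set of edges
that meet the first `k` vertices. -/
theorem exists_split_of_minimal {M : ℕ} (hd : Antitone d) (hpos : ∀ i, 0 < d i)
    (hreal : ∃ G : SimpleGraph (Fin n), ∀ v, deg G v = d v) (hk : k ≤ n)
    (hkmin : ∀ k' < k, ¬ ∃ M H e, IsState d (initial n k') M H e)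
    (hMmin : ∀ M' < M, ¬ ∃ H e, IsState d (initial n k) M' H e)
    {H : SimpleGraph (Fin n)} {e : Fin n → ℕ} (hs : IsState d (initial n k) M H e) :
    ∃ F : SimpleGraph (Fin n),
      (∀ x z, F.Adj x z → x ∈ initial n k ∨ z ∈ initial n k) ∧
      (∀ i ∈ initial n k, deg F i = d i) ∧ ∀ i, i ∉ initial n k → deg F i = e i := by
  rcases k with _ | k
  · rcases n with _ | n
    · exact ⟨⊥, fun x => x.elim0, fun x => x.elim0, fun x => x.elim0⟩
    · have h1 := hs.pos 0 (by simp)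
      have h2 := hs.le 0 (by simp)
      rw [card_initial hk] at h2
      omega
  -- By monotonicity the last of the first `k + 1` vertices has the least degree among them and at
  -- least the degree of every vertex outside.
  · refine hs.exists_split hreal (c := ⟨k, hk⟩) (by simp) (fun v hv => hd ?_) (fun i hi => hd ?_)
      (hpos _) ?_ (fun h => hMmin _ (by omega))
    · have : k + 1 ≤ v.val := by simpa using hv
      exact Fin.le_def.2 (by simp only; omega)
    · have : i.val < k + 1 := by simpa using hi
      exact Fin.le_def.2 (by simp only; omega)
    · rw [erase_initial]
      exact hkmin k (Nat.lt_succ_self k)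

theorem exists_isState_of_realizes (hd : Antitone d) (hpos : ∀ i, 0 < d i)
    {G : SimpleGraph (Fin n)} (hG : ∀ v, deg G v = d v) {D : Finset (Fin n)}
    (hD : IsDominatingSet G D) : ∃ M H e, IsState d (initial n D.card) M H e := by
  obtain ⟨G', h1, h2⟩ := exists_isDominatingSet_initial hd hpos _ G D hG hD rfl
  exact exists_isState h1 h2

theorem exists_card_eq_dominationNumber (G : SimpleGraph (Fin n)) :
    ∃ D : Finset (Fin n), IsDominatingSet G D ∧ D.card = dominationNumber G :=
  Nat.sInf_mem (s := {k | ∃ D : Finset (Fin n), IsDominatingSet G D ∧ D.card = k})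
    ⟨_, univ, fun v hv => absurd (mem_univ v) hv, rfl⟩

theorem realizes_iff {G : SimpleGraph (Fin n)} : Realizes G d ↔ ∀ v, deg G v = d v := by
  simp only [Realizes, ncard_neighborSet]

theorem ensures_isOptimalRealization (h : IsGraphic d) :
    Ensures (n * n + n + 1) program (inputMemory d) fun m => ∃ G : SimpleGraph (Fin n),
      OutputsGraph m G ∧ IsOptimalRealization G d := by
  classical
  obtain ⟨hd, hpos, G₀, hG₀⟩ := h
  rw [realizes_iff] at hG₀
  have hP : ∃ k, ∃ M H e, IsState d (initial n k) M H e :=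
    ⟨_, exists_isState_of_realizes hd hpos hG₀ (D := univ) fun v hv => absurd (mem_univ v) hv⟩
  have hk : Nat.find hP ≤ n := Nat.find_min' hP (by
    simpa using exists_isState_of_realizes hd hpos hG₀ (D := univ)
      fun v hv => absurd (mem_univ v) hv)
  have hkmin : ∀ k' < Nat.find hP, ¬ ∃ M H e, IsState d (initial n k') M H e :=
    fun _ => Nat.find_min hP
  have hM := Nat.find_spec hP
  -- The least `k` that admits a state is a lower bound for every realization, since a smallest
  -- dominating set yields a state of its size.
  have hle : ∀ G : SimpleGraph (Fin n), (∀ v, deg G v = d v) →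
      Nat.find hP ≤ dominationNumber G := fun G hG => by
    obtain ⟨D, hD, hc⟩ := exists_card_eq_dominationNumber G
    rw [← hc]
    exact Nat.find_min' hP (exists_isState_of_realizes hd hpos hG hD)
  generalize Nat.find hP = k at hk hkmin hM hle
  obtain ⟨H, e, hs⟩ := Nat.find_spec hM
  have hMmin : ∀ M' < Nat.find hM, ¬ ∃ H e, IsState d (initial n k) M' H e :=
    fun _ => Nat.find_min hM
  generalize Nat.find hM = M at hs hMmin
  have h1 : (initial n k)ᶜ.card ≤ ∑ v ∈ (initial n k)ᶜ, e v := by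
    rw [card_eq_sum_ones]
    exact sum_le_sum fun v hv => hs.pos v (mem_compl.1 hv)
  have h2 : ∑ v ∈ (initial n k)ᶜ, e v ≤ n * n := by
    refine (sum_le_card_nsmul _ _ n fun v hv => ?_).trans ?_
    · have := hs.le v (mem_compl.1 hv)
      rw [card_initial hk] at this
      omega
    · rw [smul_eq_mul]
      refine Nat.mul_le_mul_right _ ((card_le_univ _).trans ?_)
      rw [Fintype.card_fin]
  have h3 := hs.sum
  refine (ensures_program (k := k) (M := M)
    (E := ∑ v ∈ (initial n k)ᶜ, e v - (initial n k)ᶜ.card) le_rfl hpos hk (by omega) (by omega)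
    ⟨H, e, hs⟩ fun H' e' hs' =>
      exists_split_of_minimal hd hpos ⟨G₀, hG₀⟩ hk hkmin hMmin hs').mono ?_
  rintro m - ⟨G, hG, hdeg, D, hD, hdom⟩
  refine ⟨G, hG, realizes_iff.2 hdeg, fun G' hG' => ?_⟩
  calc dominationNumber G ≤ D.card := Nat.sInf_le ⟨D, hdom, rfl⟩
    _ ≤ k := hD
    _ ≤ dominationNumber G' := hle G' (realizes_iff.1 hG')

end Optimal

end DomRealization

/-- A single program of the machine model constructs, in time polynomial in the length `n` of the
sequence, an optimal realization of every given graphic sequence. -/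
theorem mainTheorem2 :
    ∃ (P : RAM.Program) (T : Polynomial ℕ),
      ∀ (n : ℕ) (d : Fin n → ℕ), IsGraphic d →
        ∃ (m : RAM.Memory) (c : ℕ) (G : SimpleGraph (Fin n)),
          RAM.Runs P (inputMemory d) m c ∧ c ≤ T.eval n ∧
            OutputsGraph m G ∧ IsOptimalRealization G d := by
  -- The cost polynomial takes the bound `n * n + n + 1` for the number of rounds of a loop as its
  -- argument.
  refine ⟨DomRealization.program, (DomRealization.costPoly DomRealization.program).comp
    (Polynomial.X * Polynomial.X + Polynomial.X + 1), fun n d h => ?_⟩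
  obtain ⟨m, c, h1, h2, G, h3, h4⟩ := DomRealization.ensures_isOptimalRealization h
  exact ⟨m, c, G, h1, by simpa using h2, h3, h4⟩
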